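/- Setting. Let $\mathcal V=\mathcal O\sqcup\mathcal L\sqcup\mathcal S$ be a finite set of random variables with values in standard Borel spaces (observed, latent and selection variables), let $\mathcal G_{\mathcal V}$ be a directed acyclic graph with vertex set $\mathcal V$, and let the joint distribution $P$ of $\mathcal V$ be faithful to $\mathcal G_{\mathcal V}$: for all distinct $A,B\in\mathcal V$ and all $\mathbf C\subseteq\mathcal V\setminus\{A,B\}$, $A$ and $B$ are conditionally independent given $\mathbf C$ under $P$ if and only if $\mathbf C$ m-separates (d-separates) them in $\mathcal G_{\mathcal V}$. For $\mathbf W\subseteq\mathcal O$, write $Y\perp\!\!\!\perp Z\mid\mathbf W$ if $Y$ and $Z$ are conditionally independent given $\mathbf W\cup\mathcal S$ under $P$. Definitions. A mixed graph has edges $-$, $\to$, $\leftrightarrow$, at most one between two vertices. Paths do not repeat vertices. $\mathrm{Anc}(\mathbf A)$ is the set of vertices with a directed path, possibly of length zero, to a vertex of $\mathbf A$. A non-endpoint vertex of a path is a collider if both edges of the path at it have an arrowhead there. A set $\mathbf Z$ m-separates $A$ and $B$ if there is no path between them on which every non-endpoint non-collider is outside $\mathbf Z$ and every collider is in $\mathrm{Anc}(\{A,B\}\cup\mathbf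 Z)$. For $\mathbf V\subseteq\mathcal O$, the projection $\mathcal G_{\mathcal V}[\mathbf V|\mathcal S]$ is the mixed graph on $\mathbf V$ in which distinct $A,B$ are adjacent if and only if $\mathcal G_{\mathcal V}$ has a path between them on which every non-endpoint non-collider is in $\mathcal V\setminus(\mathbf V\cup\mathcal S)$ and every collider is in $\mathrm{Anc}(\{A,B\}\cup\mathcal S)$; the mark at $B$ of the edge between $A$ and $B$ is a tail if $B\in\mathrm{Anc}(\{A\}\cup\mathcal S)$ and an arrowhead otherwise (ancestors in $\mathcal G_{\mathcal V}$). A vertex $X$ of a mixed graph $\mathcal G$ on $\mathbf V$ is removable if, with $\mathcal H$ the induced subgraph on $\mathbf V\setminus\{X\}$, for all $Y,W\in\mathbf V\setminus\{X\}$ and $\mathbf Z\subseteq\mathbf V\setminus\{X,Y,W\}$, $\mathbf Z$ m-separates $Y$ and $W$ in $\mathcal G$ if and only if it does in $\mathcal H$. A Markov boundary $\mathrm{Mb}_{\mathbf V}(X)$ of $X\in\mathbf V$ is an inclusion-minimal set $\mathbf Z\subseteq\mathbf V\setminus\{X\}$ such that $X$ is (jointly) independent of $\mathbf V\setminus(\{X\}\cup\mathbf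 Z)$ given $\mathbf Z\cup\mathcal S$ under $P$. Theorem. Let $\mathcal M=\mathcal G_{\mathcal V}[\mathcal O|\mathcal S]$ be the ground-truth MAG, and suppose that the graph formed by the undirected edges of $\mathcal M$ is chordal (every cycle of length at least four has a chord). Let $\emptyset\ne\mathbf V\subseteq\mathcal O$ and $\mathcal G=\mathcal G_{\mathcal V}[\mathbf V|\mathcal S]$. Then $X\in\mathbf V$ is removable in $\mathcal G$ if and only if for every $Y$ adjacent to $X$ in $\mathcal G$ and every $Z\in\mathrm{Mb}_{\mathbf V}(X)$ with $Z\neq Y$, at least one of the following holds: 1. there is $\mathbf W\subseteq\mathrm{Mb}_{\mathbf V}(X)\setminus\{Y,Z\}$ with $Y\perp\!\!\!\perp Z\mid\mathbf W$; 2. for every $\mathbf W\subseteq\mathrm{Mb}_{\mathbf V}(X)\setminus\{Y,Z\}$, $Y\not\perp\!\!\!\perp Z\mid\mathbf W\cup\{X\}$. Furthermore, the set of removable vertices of $\mathcal G$ is non-empty. -/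

import Mathlib

open MeasureTheory ProbabilityTheory

/-- A mixed graph with vertex set `verts`, with at most one edge between two vertices. `skeleton` is
its skeleton, and `head a b` says that there is an edge between `a` and `b` and that its mark at `b`
is an arrowhead (the other mark is a tail). -/
structure MixedGraph (α : Type*) where
  verts : Set α
  skeleton : SimpleGraph α
  head : α → α → Prop
  mem_of_adj : ∀ a b, skeleton.Adj a b → a ∈ verts
  adj_of_head : ∀ a b, head a b → skeleton.Adj a b

namespace MixedGraph

variable {α : Type*} (G : MixedGraph α)

/-- The directed edge `a → b`: `a` is a parent of `b`. -/
def Dir (a b : α) : Prop := G.head a b ∧ ¬ G.head b a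

/-- The undirected edge `a − b`: `a` and `b` are neighbors. -/
def Undir (a b : α) : Prop := G.skeleton.Adj a b ∧ ¬ G.head a b ∧ ¬ G.head b a

/-- The set `A` together with all ancestors of its members. -/
def Anc (A : Set α) : Set α := {v | ∃ a ∈ A, Relation.ReflTransGen G.Dir v a}

/-- A directed acyclic graph: every edge is directed, and there is no directed cycle, that is, no
edge `a → b` with `b` an ancestor of `a`. -/
def IsDAG : Prop :=
  (∀ a b, G.skeleton.Adj a b → G.Dir a b ∨ G.Dir b a) ∧
    ∀ a b, G.Dir a b → b ∉ G.Anc {a}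

/-- The non-endpoint vertex number `i + 1` of the walk `p` is a collider on `p`
(used for `i + 2 ≤ p.length`, so that vertex number `i + 1` is not an endpoint). -/
def IsColliderAt {x y : α} (p : G.skeleton.Walk x y) (i : ℕ) : Prop :=
  G.head (p.getVert i) (p.getVert (i + 1)) ∧ G.head (p.getVert (i + 2)) (p.getVert (i + 1))

/-- `p` is an m-connecting path relative to `Z`. -/
def IsMConnecting {x y : α} (p : G.skeleton.Walk x y) (Z : Set α) : Prop :=
  p.IsPath ∧ ∀ i, i + 2 ≤ p.length →
    (¬ G.IsColliderAt p i → p.getVert (i + 1) ∉ Z) ∧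
    (G.IsColliderAt p i → p.getVert (i + 1) ∈ G.Anc ({x, y} ∪ Z))

/-- `Z` m-separates `x` and `y`. -/
def MSep (x y : α) (Z : Set α) : Prop :=
  ¬ ∃ p : G.skeleton.Walk x y, G.IsMConnecting p Z

/-- `p` is an inducing path relative to `⟨L, S⟩`. -/
def IsInducing {x y : α} (p : G.skeleton.Walk x y) (L S : Set α) : Prop :=
  p.IsPath ∧ ∀ i, i + 2 ≤ p.length →
    (¬ G.IsColliderAt p i → p.getVert (i + 1) ∈ L) ∧
    (G.IsColliderAt p i → p.getVert (i + 1) ∈ G.Anc ({x, y} ∪ S))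

/-- Existence of an inducing path does not depend on the order of the endpoints. -/
theorem exists_isInducing_symm {x y : α} {L S : Set α}
    (h : ∃ p : G.skeleton.Walk x y, G.IsInducing p L S) :
    ∃ p : G.skeleton.Walk y x, G.IsInducing p L S := by
  obtain ⟨p, hp, h⟩ := h
  refine ⟨p.reverse, hp.reverse, fun i hi => ?_⟩
  rw [SimpleGraph.Walk.length_reverse] at hi
  obtain ⟨j, hj⟩ := Nat.exists_eq_add_of_le hi
  have e0 : p.length - i = j + 2 := by omega
  have e1 : p.length - (i + 1) = j + 1 := by omega
  have e2 : p.length - (i + 2) = j := by omega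
  have := h j (by omega)
  simp only [IsColliderAt, SimpleGraph.Walk.getVert_reverse, e0, e1, e2] at this ⊢
  rw [Set.pair_comm y x, and_comm (a := G.head (p.getVert (j + 2)) _)]
  exact this

/-- The latent projection `G[V | S]` over `V` conditioned on `S`; all remaining vertices of `G` are
latent. Between adjacent `a` and `b`, the mark at `b` is a tail if `b` is an ancestor of
`{a} ∪ S`, and an arrowhead otherwise. -/
def proj (V S : Set α) : MixedGraph α where
  verts := V
  skeleton :=
    { Adj := fun a b => a ∈ V ∧ b ∈ V ∧ a ≠ b ∧
        ∃ p : G.skeleton.Walk a b, G.IsInducing p (G.verts \ (V ∪ S)) S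
      symm := ⟨fun _ _ h => ⟨h.2.1, h.1, h.2.2.1.symm, G.exists_isInducing_symm h.2.2.2⟩⟩
      loopless := ⟨fun _ h => h.2.2.1 rfl⟩ }
  head := fun a b => (a ∈ V ∧ b ∈ V ∧ a ≠ b ∧
      ∃ p : G.skeleton.Walk a b, G.IsInducing p (G.verts \ (V ∪ S)) S) ∧
    b ∉ G.Anc ({a} ∪ S)
  mem_of_adj := fun _ _ h => h.1
  adj_of_head := fun _ _ h => h.1

/-- The induced subgraph over the vertices in `A`. -/
def induce (A : Set α) : MixedGraph α where
  verts := G.verts ∩ A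
  skeleton :=
    { Adj := fun a b => G.skeleton.Adj a b ∧ a ∈ A ∧ b ∈ A
      symm := ⟨fun _ _ h => ⟨h.1.symm, h.2.2, h.2.1⟩⟩
      loopless := ⟨fun _ h => h.1.ne rfl⟩ }
  head := fun a b => G.head a b ∧ a ∈ A ∧ b ∈ A
  mem_of_adj := fun a b h => ⟨G.mem_of_adj a b h.1, h.2.1⟩
  adj_of_head := fun a b h => ⟨G.adj_of_head a b h.1, h.2⟩

/-- The vertex `X` is removable in `G`: `G` and its induced subgraph over the other vertices impose
the same m-separations over these vertices. -/
def Removable (X : α) : Prop :=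
  X ∈ G.verts ∧ ∀ Y ∈ G.verts \ {X}, ∀ W ∈ G.verts \ {X}, ∀ Z ⊆ G.verts \ {X, Y, W},
    (G.MSep Y W Z ↔ (G.induce (G.verts \ {X})).MSep Y W Z)

/-- The graph formed by the undirected edges of `G`. -/
def undirected : SimpleGraph α where
  Adj := G.Undir
  symm := ⟨fun _ _ h => ⟨h.1.symm, h.2.2, h.2.1⟩⟩
  loopless := ⟨fun _ h => h.1.ne rfl⟩

end MixedGraph

/-- A graph is chordal if every cycle of length at least four has a chord: an edge between two of
its vertices that is not an edge of the cycle. -/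
def SimpleGraph.IsChordal {α : Type*} (H : SimpleGraph α) : Prop :=
  ∀ (v : α) (c : H.Walk v v), c.IsCycle → 4 ≤ c.length →
    ∃ a ∈ c.support, ∃ b ∈ c.support, H.Adj a b ∧ s(a, b) ∉ c.edges

section Probability

variable {ι : Type*} [Finite ι] {E : ι → Type*} [∀ i, MeasurableSpace (E i)]
  [∀ i, StandardBorelSpace (E i)]

/-- Under the joint distribution `P` of the variables indexed by `ι` (the coordinates of the product
space), the random vectors of the variables in `A` and in `B` are conditionally independent given
the variables in `C`. -/
def CI (P : Measure (∀ i, E i)) [IsFiniteMeasure P] (A B C : Set ι) : Prop :=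
  CondIndepFun (MeasurableSpace.comap (C.domRestrict (π := E)) inferInstance)
    (Measurable.comap_le (Set.measurable_restrict C)) (A.domRestrict (π := E)) (B.domRestrict (π := E)) P

/-- `P` is faithful with respect to `G`: conditional independence of two variables given a set of
other variables is equivalent to m-separation (d-separation, for a directed acyclic graph). -/
def Faithful (P : Measure (∀ i, E i)) [IsFiniteMeasure P] (G : MixedGraph ι) : Prop :=
  ∀ X ∈ G.verts, ∀ Y ∈ G.verts, X ≠ Y → ∀ Z ⊆ G.verts \ {X, Y},
    (CI P {X} {Y} Z ↔ G.MSep X Y Z)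

/-- `B` is a Markov boundary of `X` with respect to `V`, with selection variables `S`: a minimal
subset of `V \ {X}` such that `X` is independent of the rest of `V` given `B ∪ S`. -/
def IsMarkovBoundary (P : Measure (∀ i, E i)) [IsFiniteMeasure P] (S V : Set ι) (X : ι)
    (B : Set ι) : Prop :=
  Minimal (fun Z : Set ι => Z ⊆ V \ {X} ∧ CI P {X} (V \ ({X} ∪ Z)) (Z ∪ S)) B

end Probability

/-!
The theorem is deduced from a graphical description of removability.

*Projections.* It is convenient to replace paths by trails, which may repeat vertices: in graphs
without undirected edges at arrowheads, two distinct vertices are m-connected if and only if there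
is an open trail between them (`not_MSep_iff`). An edge of the projection of a DAG stands for an
inducing trail of the DAG, which has an arrowhead wherever the edge has one. So an open trail of the
projection gives a chain of such trails, and conversely an open trail of the DAG can be cut into a
reduced chain. Hence m-separation in the projection on `V` given `W` is m-separation in the DAG
given `W ∪ S` (`proj_MSep_iff`). Two vertices of the projection that no `W ⊆ U` separates are
exactly those joined by an inducing trail relative to `U`, on which every inner non-collider is
outside of `U` and every collider is an ancestor of an endpoint (`forall_not_MSep_iff_inducing`);
for `U = V` these are the adjacent vertices, which is the maximality of the projection.

*Removability.* The projection on `V \ {X}` has the right separations for the graph without `X`. So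
`X` is removable if and only if marginalizing `X` creates no new adjacency, that is, vertices joined
by an inducing trail relative to `V \ {X}` are already adjacent (`proj_removable_iff`).

*The local condition.* By weak union and faithfulness, a Markov boundary `Mb` of `X` contains every
vertex reached from `X` by a walk whose inner vertices are colliders
(`IsMarkovBoundary.mem_of_trail`). In graphical terms, the condition on `Y` and `Z` says that an
inducing trail between them relative to `Mb` yields one relative to `Mb ∪ {X}`. If `X` is removable
this holds, since an inducing trail relative to `Mb` with `X` as a non-collider has no other
non-collider, so it is inducing relative to `V \ {X}` and its endpoints are adjacent
(`Inducing.insert_of_removable`). Conversely, a new adjacency caused by removing `X` comes from an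
inducing trail on which `X` is the only non-collider, all of whose vertices are in `Mb ∪ {X}`, and
the condition, applied along this trail, gives the adjacency of its endpoints
(`adj_of_inducing_of_criterion`). Chordality enters where `X` lies on undirected edges: in the form
that two separate connections of `y` and `z` by undirected paths force their adjacency
(`SimpleGraph.CliqueSeparators`), it passes from the projection on `O` to that on `V`
(`proj_undirected_cliqueSeparators`).

*Existence.* If some vertex of `V` is not an ancestor of `S`, a vertex without proper descendants
among such vertices can be removed. Otherwise all edges of the projection are undirected, so that it
is a chordal graph, and a simplicial vertex, which exists by a theorem of Dirac, can be removed
(`exists_proj_removable`).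
-/

namespace MixedGraph

/-! ### Trails -/

section Trail

variable {α : Type*} {G : MixedGraph α} {N C : Set α}

/-- The condition that a trail may run through the vertex `v`, where `s` and `t` say that the edge
before and the edge after `v` have an arrowhead at `v`: non-colliders have to be in `N` and
colliders in `C`. -/
def Pass (N C : Set α) (s : Prop) (v : α) (t : Prop) : Prop :=
  (¬(s ∧ t) → v ∈ N) ∧ (s ∧ t → v ∈ C)

/-- `G.Trail N C x s y t`: there is a walk of positive length from `x` to `y` whose inner
non-colliders are in `N` and whose inner colliders are in `C`. The propositions `s` and `t` say that
the first edge has an arrowhead at `x` and the last edge an arrowhead at `y`. Vertices may be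
repeated. -/
inductive Trail (G : MixedGraph α) (N C : Set α) : α → Prop → α → Prop → Prop
  | edge {x y : α} : G.skeleton.Adj x y → Trail G N C x (G.head y x) y (G.head x y)
  | cons {x y z : α} {s t : Prop} : G.skeleton.Adj x y → Pass N C (G.head x y) y s →
      Trail G N C y s z t → Trail G N C x (G.head y x) z t

theorem Pass.mono {N' C' : Set α} {s t : Prop} {v : α} (h : Pass N C s v t) (hN : N ⊆ N')
    (hC : C ⊆ C') : Pass N' C' s v t :=
  ⟨fun h' => hN (h.1 h'), fun h' => hC (h.2 h')⟩

theorem Pass.symm {s t : Prop} {v : α} (h : Pass N C s v t) : Pass N C t v s :=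
  ⟨fun h' => h.1 fun k => h' k.symm, fun h' => h.2 h'.symm⟩

theorem Pass.collider {s t : Prop} {v : α} (h : Pass ∅ C s v t) : s ∧ t :=
  by_contra fun k => h.1 k

namespace Trail

variable {x y z : α} {s t u v : Prop}

theorem mono {N' C' : Set α} (h : G.Trail N C x s y t) (hN : N ⊆ N') (hC : C ⊆ C') :
    G.Trail N' C' x s y t := by
  induction h with
  | edge h => exact .edge h
  | cons h p _ ih => exact .cons h (p.mono hN hC) ih

theorem trans (h : G.Trail N C x s y t) (p : Pass N C t y u) (h' : G.Trail N C y u z v) :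
    G.Trail N C x s z v := by
  induction h with
  | edge h => exact .cons h p h'
  | cons h q _ ih => exact .cons h q (ih p h')

theorem symm (h : G.Trail N C x s y t) : G.Trail N C y t x s := by
  induction h with
  | edge h => exact .edge h.symm
  | cons h p _ ih => exact ih.trans p.symm (.edge h.symm)

theorem exists_adj_left (h : G.Trail N C x s y t) : ∃ w, G.skeleton.Adj x w ∧ (s ↔ G.head w x) := by
  cases h with
  | edge h => exact ⟨_, h, Iff.rfl⟩
  | cons h _ _ => exact ⟨_, h, Iff.rfl⟩

theorem mem_left (h : G.Trail N C x s y t) : x ∈ G.verts := by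
  obtain ⟨w, h, _⟩ := h.exists_adj_left
  exact G.mem_of_adj _ _ h

theorem exists_head_left (h : G.Trail N C x s y t) (hs : s) : ∃ w, G.head w x := by
  obtain ⟨w, _, h⟩ := h.exists_adj_left
  exact ⟨w, h.1 hs⟩

/-- Transport of a trail along a map of adjacencies that preserves the marks of edges. -/
theorem map {H : MixedGraph α} {N' C' : Set α} (h : H.Trail N C x s y t)
    (hadj : ∀ a b, H.skeleton.Adj a b → G.skeleton.Adj a b)
    (hhead : ∀ a b, H.skeleton.Adj a b → (H.head a b ↔ G.head a b))
    (hN : N ∩ H.verts ⊆ N') (hC : C ∩ H.verts ⊆ C') : G.Trail N' C' x s y t := by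
  induction h with
  | edge h =>
    rw [hhead _ _ h, hhead _ _ h.symm]
    exact .edge (hadj _ _ h)
  | cons h p T ih =>
    rw [hhead _ _ h] at p
    rw [hhead _ _ h.symm]
    exact .cons (hadj _ _ h) ⟨fun k => hN ⟨p.1 k, T.mem_left⟩, fun k => hC ⟨p.2 k, T.mem_left⟩⟩ ih

/-- Inner vertices may be assumed to be vertices of the graph, and inner colliders to have an
arrowhead. -/
theorem refine_sets (h : G.Trail N C x s y t) :
    G.Trail (N ∩ G.verts) {c ∈ C | ∃ w, G.head w c} x s y t := by
  induction h with
  | edge h => exact .edge h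
  | cons h p T ih =>
    exact .cons h ⟨fun k => ⟨p.1 k, T.mem_left⟩, fun k => ⟨p.2 k, _, k.1⟩⟩ ih

end Trail

theorem subset_Anc (A : Set α) : A ⊆ G.Anc A := fun a ha => ⟨a, ha, .refl⟩

theorem Anc_mono {A B : Set α} (h : A ⊆ B) : G.Anc A ⊆ G.Anc B :=
  fun _ ⟨a, ha, h'⟩ => ⟨a, h ha, h'⟩

theorem mem_Anc_of_Dir {A : Set α} {a b : α} (h : G.Dir a b) (hb : b ∈ G.Anc A) : a ∈ G.Anc A := by
  obtain ⟨c, hc, h'⟩ := hb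
  exact ⟨c, hc, .head h h'⟩

theorem Anc_Anc (A : Set α) : G.Anc (G.Anc A) = G.Anc A :=
  Set.Subset.antisymm (fun _ ⟨_, ⟨c, hc, h₁⟩, h₂⟩ => ⟨c, hc, h₂.trans h₁⟩) (subset_Anc _)

theorem Anc_subset {A B : Set α} (h : A ⊆ G.Anc B) : G.Anc A ⊆ G.Anc B :=
  (Anc_mono h).trans (Anc_Anc B).subset

theorem mem_Anc_trans {B : Set α} {a b : α} (h : a ∈ G.Anc {b}) (hb : b ∈ G.Anc B) :
    a ∈ G.Anc B :=
  Anc_subset (by simpa using hb) h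

theorem Anc_union (A B : Set α) : G.Anc (A ∪ B) = G.Anc A ∪ G.Anc B := by
  ext v
  constructor
  · rintro ⟨a, ha | ha, h⟩
    exacts [.inl ⟨a, ha, h⟩, .inr ⟨a, ha, h⟩]
  · rintro (h | h)
    exacts [Anc_mono Set.subset_union_left h, Anc_mono Set.subset_union_right h]

/-- A vertex at which some edge has an arrowhead is not incident to an undirected edge. -/
def NoUndirAtHead (G : MixedGraph α) : Prop :=
  ∀ a b, G.head b a → ∀ c, G.skeleton.Adj a c → G.head c a ∨ G.head a c

/-- A set is closed under taking ancestors. -/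
def AncClosed (G : MixedGraph α) (C : Set α) : Prop := ∀ a b, G.Dir a b → b ∈ C → a ∈ C

theorem ancClosed_Anc (A : Set α) : G.AncClosed (G.Anc A) := fun _ _ h hb => mem_Anc_of_Dir h hb

/-- A trail that leaves `x` through a tail of a directed edge goes on along directed edges until a
collider or its end is reached. -/
theorem Trail.exists_Dir {x z : α} {s t : Prop} (hG : G.NoUndirAtHead) (hC : G.AncClosed C)
    (h : G.Trail N C x s z t) (hz : z ∈ C)
    (hx : ∀ c, G.skeleton.Adj x c → G.head c x ∨ G.head x c) (hs : ¬ s) :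
    ∃ c, G.Dir x c ∧ c ∈ C := by
  induction h with
  | edge h => exact ⟨_, ⟨(hx _ h).resolve_left hs, hs⟩, hz⟩
  | @cons x y z s t h p T ih =>
    have hxy := (hx _ h).resolve_left hs
    refine ⟨y, ⟨hxy, hs⟩, ?_⟩
    by_cases h' : s
    · exact p.2 ⟨hxy, h'⟩
    · obtain ⟨c, hc, hc'⟩ := ih hz (hG _ _ hxy) h'
      exact hC _ _ hc hc'

/-- A trail either does not have `x` as an inner non-collider, or it splits at the first such
occurrence of `x`. -/
theorem Trail.split {y z : α} {s t : Prop} (h : G.Trail N C y s z t) (x : α) :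
    G.Trail (N \ {x}) C y s z t ∨ ∃ m m', ¬(m ∧ m') ∧ G.Trail (N \ {x}) C y s x m ∧
      G.Trail N C x m' z t := by
  induction h with
  | edge h => exact .inl (.edge h)
  | @cons a y z s t h p T ih =>
    by_cases hy : y = x ∧ ¬(G.head a y ∧ s)
    · obtain ⟨rfl, hy⟩ := hy
      exact .inr ⟨_, s, hy, .edge h, T⟩
    · have p' : Pass (N \ {x}) C (G.head a y) y s :=
        ⟨fun k => ⟨p.1 k, fun e => hy ⟨e, k⟩⟩, p.2⟩
      obtain ih | ⟨m, m', hm, h₁, h₂⟩ := ih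
      · exact .inl (.cons h p' ih)
      · exact .inr ⟨m, m', hm, .cons h p' h₁, h₂⟩

/-- A trail can be chosen without `x` as an inner non-collider, or so that `x` is its only such
non-collider at a single place. If the marks at the first and the last occurrence of `x` are both
arrowheads, then the part in between can be left out, as one of its tails shows that `x` is in `C`. -/
theorem Trail.split_both {y z : α} {s t : Prop} (hG : G.NoUndirAtHead) (hC : G.AncClosed C)
    (h : G.Trail N C y s z t) (hz : z ∈ C) (x : α) :
    G.Trail (N \ {x}) C y s z t ∨ ∃ m m', ¬(m ∧ m') ∧ G.Trail (N \ {x}) C y s x m ∧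
      G.Trail (N \ {x}) C x m' z t := by
  obtain h' | ⟨m, m', hm, h₁, h₂⟩ := h.split x
  · exact .inl h'
  obtain h' | ⟨n, n', hn, h₃, h₄⟩ := h₂.symm.split x
  · exact .inr ⟨m, m', hm, h₁, h'.symm⟩
  by_cases hmn : m ∧ n
  · have hx : x ∈ C := by
      by_cases hm' : m'
      · exact absurd ⟨hmn.1, hm'⟩ hm
      · obtain ⟨c, hc, hc'⟩ := h₂.exists_Dir hG hC hz
          (by obtain ⟨w, hw⟩ := h₁.symm.exists_head_left hmn.1; exact hG _ _ hw) hm'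
        exact hC _ _ hc hc'
    exact .inl (h₁.trans ⟨fun k => absurd hmn k, fun _ => hx⟩ h₃.symm)
  · exact .inr ⟨m, n, hmn, h₁, h₃.symm⟩

end Trail

/-! ### Trails and paths -/

section Path

variable {α : Type*} {G : MixedGraph α} {N C : Set α}

/-- The inner non-colliders of the walk `p` are in `N` and its inner colliders in `C`. -/
def IsOpen (G : MixedGraph α) (N C : Set α) {x y : α} (p : G.skeleton.Walk x y) : Prop :=
  ∀ i, i + 2 ≤ p.length → (¬ G.IsColliderAt p i → p.getVert (i + 1) ∈ N) ∧
    (G.IsColliderAt p i → p.getVert (i + 1) ∈ C)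

theorem isOpen_cons_iff {x y z : α} (h : G.skeleton.Adj x y) (p : G.skeleton.Walk y z) :
    G.IsOpen N C (.cons h p) ↔
      (¬ p.Nil → Pass N C (G.head x y) y (G.head (p.getVert 1) y)) ∧ G.IsOpen N C p := by
  constructor
  · intro H
    refine ⟨fun hp => ?_, fun i hi => ?_⟩
    · have := H 0 (by
        have : p.length ≠ 0 := fun h => hp (SimpleGraph.Walk.length_eq_zero_iff.1 h)
        simp only [SimpleGraph.Walk.length_cons]; omega)
      simpa [IsColliderAt, Pass] using this
    · have := H (i + 1) (by simp only [SimpleGraph.Walk.length_cons]; omega)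
      simpa [IsColliderAt] using this
  · rintro ⟨H₁, H₂⟩ (_ | i) hi
    · have := H₁ (fun h => by
        have := SimpleGraph.Walk.length_eq_zero_iff.2 h
        simp only [SimpleGraph.Walk.length_cons] at hi; omega)
      simpa [IsColliderAt, Pass] using this
    · have := H₂ i (by simp only [SimpleGraph.Walk.length_cons] at hi; omega)
      simpa [IsColliderAt] using this

theorem IsOpen.trail {x z : α} {p : G.skeleton.Walk x z} (hp : G.IsOpen N C p) (hn : ¬ p.Nil) :
    ∃ t, G.Trail N C x (G.head (p.getVert 1) x) z t := by
  induction p with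
  | nil => simp at hn
  | @cons x y z h p ih =>
    rw [isOpen_cons_iff] at hp
    simp only [SimpleGraph.Walk.getVert_cons_succ, SimpleGraph.Walk.getVert_zero]
    by_cases hp' : p.Nil
    · obtain rfl := hp'.eq
      exact ⟨_, .edge h⟩
    · obtain ⟨t, ht⟩ := ih hp.2 hp'
      exact ⟨t, .cons h (hp.1 hp') ht⟩

/-- The part of an open path from a vertex `u` on is open, and the path runs through `u`. -/
theorem IsOpen.exists_suffix {x z u : α} {p : G.skeleton.Walk x z} (hp : G.IsOpen N C p)
    (hpath : p.IsPath) (hu : u ∈ p.support) (hux : u ≠ x) :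
    ∃ r : G.skeleton.Walk u z, r.IsPath ∧ G.IsOpen N C r ∧
      (¬ r.Nil → ∃ m, Pass N C m u (G.head (r.getVert 1) u)) := by
  induction p with
  | nil => simp_all
  | @cons x y z h p ih =>
    rw [isOpen_cons_iff] at hp
    rw [SimpleGraph.Walk.cons_isPath_iff] at hpath
    by_cases huy : u = y
    · subst huy
      exact ⟨p, hpath.1, hp.2, fun hn => ⟨_, hp.1 hn⟩⟩
    · refine ih hp.2 hpath.1 ?_ huy
      simpa [hux] using hu

/-- In a graph in which arrowheads and undirected edges do not meet, an open trail can be shortened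
to an open path. The third property of the path, that it can replace the trail as the continuation
of an edge into `x`, is what the induction needs. -/
theorem Trail.exists_path_aux {x z : α} {s t : Prop} (hG : G.NoUndirAtHead) (hC : G.AncClosed C)
    (h : G.Trail N C x s z t) (hz : z ∈ C) :
    ∃ p : G.skeleton.Walk x z, p.IsPath ∧ G.IsOpen N C p ∧ (¬ p.Nil → ∀ m : Prop,
      (m → ∃ w, G.head w x) → Pass N C m x s → Pass N C m x (G.head (p.getVert 1) x)) := by
  induction h with
  | @edge x y h =>
    refine ⟨.cons h .nil, by simpa using h.ne, fun i hi => ?_, fun _ m _ hm => by simpa using hm⟩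
    simp at hi
  | @cons x y z s t h p T ih =>
    obtain ⟨q, hq, hq', hq''⟩ := ih hz
    by_cases hx : x ∈ q.support
    · obtain ⟨r, hr, hr', hr''⟩ := hq'.exists_suffix hq hx h.ne
      refine ⟨r, hr, hr', fun hn m hm hp => ?_⟩
      obtain ⟨m', hm'⟩ := hr'' hn
      refine ⟨fun k => ?_, fun k => ?_⟩
      · by_cases hk : G.head (r.getVert 1) x
        · exact hp.1 fun e => k ⟨e.1, hk⟩
        · exact hm'.1 fun e => hk e.2
      · by_cases hs : G.head y x
        · exact hp.2 ⟨k.1, hs⟩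
        · obtain ⟨w, hw⟩ := hm k.1
          obtain ⟨c, hc, hc'⟩ := (Trail.cons h p T).exists_Dir hG hC hz (hG _ _ hw) hs
          exact hC _ _ hc hc'
    · refine ⟨.cons h q, by simp [SimpleGraph.Walk.cons_isPath_iff, hq, hx], ?_,
        fun _ m _ hm => by simpa using hm⟩
      rw [isOpen_cons_iff]
      exact ⟨fun hn => hq'' hn _ (fun k => ⟨_, k⟩) p, hq'⟩

theorem exists_open_path_iff_trail {x z : α} (hG : G.NoUndirAtHead) (hC : G.AncClosed C)
    (hz : z ∈ C) (hxz : x ≠ z) :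
    (∃ p : G.skeleton.Walk x z, p.IsPath ∧ G.IsOpen N C p) ↔ ∃ s t, G.Trail N C x s z t := by
  constructor
  · rintro ⟨p, -, hp⟩
    obtain ⟨t, ht⟩ := hp.trail (SimpleGraph.Walk.not_nil_of_ne hxz)
    exact ⟨_, t, ht⟩
  · rintro ⟨s, t, h⟩
    obtain ⟨p, hp, hp', -⟩ := h.exists_path_aux hG hC hz
    exact ⟨p, hp, hp'⟩

theorem not_MSep_iff {x z : α} (hG : G.NoUndirAtHead) (hxz : x ≠ z) {Z : Set α} :
    ¬ G.MSep x z Z ↔ ∃ s t, G.Trail Zᶜ (G.Anc ({x, z} ∪ Z)) x s z t := by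
  rw [← exists_open_path_iff_trail hG (ancClosed_Anc _) (subset_Anc _ (by simp)) hxz, MSep, not_not]
  rfl

theorem MSep_self (x : α) (Z : Set α) : ¬ G.MSep x x Z :=
  not_not.2 ⟨.nil, .nil, fun i hi => by simp at hi⟩

/-- The endpoints of an open trail between distinct vertices need not occur inside of it. -/
theorem Trail.exists_diff_endpoints {x z : α} {s t : Prop} (hG : G.NoUndirAtHead)
    (hC : G.AncClosed C) (h : G.Trail N C x s z t) (hz : z ∈ C) (hxz : x ≠ z) :
    ∃ s t, G.Trail (N \ {x, z}) C x s z t := by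
  obtain ⟨p, hp, hp', -⟩ := h.exists_path_aux hG hC hz
  have : G.IsOpen (N \ {x, z}) C p := fun i hi =>
    ⟨fun k => ⟨(hp' i hi).1 k, by
      rintro (e | e)
      · have := (hp.getVert_eq_start_iff (i := i + 1) (by omega)).1 e
        omega
      · have := (hp.getVert_eq_end_iff (i := i + 1) (by omega)).1 e
        omega⟩, (hp' i hi).2⟩
  obtain ⟨t, ht⟩ := this.trail (SimpleGraph.Walk.not_nil_of_ne hxz)
  exact ⟨_, t, ht⟩

end Path

end MixedGraph

namespace MixedGraph

section Projection

variable {α : Type*} {G : MixedGraph α} {V S : Set α}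

/-! ### Directed acyclic graphs -/

theorem IsDAG.head_or_head (h : G.IsDAG) {a b : α} (hab : G.skeleton.Adj a b) :
    G.head b a ∨ G.head a b :=
  (h.1 a b hab).elim (fun k => .inr k.1) (fun k => .inl k.1)

theorem IsDAG.noUndirAtHead (h : G.IsDAG) : G.NoUndirAtHead := fun _ _ _ _ => h.head_or_head

theorem IsDAG.eq_of_mem_Anc (h : G.IsDAG) {a b : α} (hab : a ∈ G.Anc {b}) (hba : b ∈ G.Anc {a}) :
    a = b := by
  obtain ⟨_, rfl, hab⟩ := hab
  obtain rfl | ⟨c, hc, hc'⟩ := hab.cases_head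
  · rfl
  · exact absurd (mem_Anc_trans ⟨_, rfl, hc'⟩ hba) (h.2 _ _ hc)

theorem IsDAG.mem_Anc_of_Dir_of_mem (h : G.IsDAG) {a c : α} {B : Set α} (hac : G.Dir a c)
    (hc : c ∈ G.Anc ({a} ∪ B)) : c ∈ G.Anc B := by
  rw [Anc_union] at hc
  exact hc.resolve_left (h.2 _ _ hac)

/-- All inner vertices of an open trail in a directed acyclic graph are ancestors of colliders or
endpoints. -/
theorem Trail.inter_of_isDAG {N C : Set α} {x z : α} {s t : Prop} (hG : G.IsDAG)
    (hC : G.AncClosed C) (h : G.Trail N C x s z t) (hx : x ∈ C) (hz : z ∈ C) :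
    G.Trail (N ∩ C) C x s z t := by
  induction h with
  | edge h => exact .edge h
  | @cons x y z s t h p T ih =>
    have hy : y ∈ C := by
      by_cases hxy : G.head x y
      · by_cases hs : s
        · exact p.2 ⟨hxy, hs⟩
        · obtain ⟨c, hc, hc'⟩ := T.exists_Dir hG.noUndirAtHead hC hz
            (fun c hc => hG.head_or_head hc) hs
          exact hC _ _ hc hc'
      · exact hC _ _ ⟨(hG.head_or_head h).resolve_right hxy, hxy⟩ hx
    exact .cons h ⟨fun k => ⟨p.1 k, hy⟩, p.2⟩ (ih hy hz)

/-! ### The marks of a latent projection -/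

/-- `G.Seg V S a b s t`: the graph `G` has an inducing trail from `a` to `b`, whose marks at
`a` and at `b` are given by `s` and `t`. -/
def Seg (G : MixedGraph α) (V S : Set α) (a b : α) (s t : Prop) : Prop :=
  G.Trail (V ∪ S)ᶜ (G.Anc ({a, b} ∪ S)) a s b t

theorem Seg.symm {a b : α} {s t : Prop} (h : G.Seg V S a b s t) : G.Seg V S b a t s := by
  rw [Seg, Set.pair_comm]
  exact Trail.symm h

/-- An inducing trail that leaves `a` through a tail shows that `a` is an ancestor of `{b} ∪ S`. The
statement is phrased with a child of `a` as it has content also if `a = b`. -/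
theorem Seg.exists_Dir (hG : G.IsDAG) {a b : α} {s t : Prop} (h : G.Seg V S a b s t) (hs : ¬ s) :
    ∃ c, G.Dir a c ∧ c ∈ G.Anc ({b} ∪ S) := by
  obtain ⟨c, hc, hc'⟩ := Trail.exists_Dir hG.noUndirAtHead (ancClosed_Anc _) h
    (subset_Anc _ (by simp)) (fun c hc => hG.head_or_head hc) hs
  rw [Set.insert_eq, Set.union_assoc] at hc'
  exact ⟨c, hc, hG.mem_Anc_of_Dir_of_mem hc hc'⟩

theorem Seg.mem_Anc (hG : G.IsDAG) {a b : α} {s t : Prop} (h : G.Seg V S a b s t) (hs : ¬ s) :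
    a ∈ G.Anc ({b} ∪ S) := by
  obtain ⟨c, hc, hc'⟩ := h.exists_Dir hG hs
  exact mem_Anc_of_Dir hc hc'

theorem Seg.mem_Anc_of_loop (hG : G.IsDAG) {a : α} {s t : Prop} (h : G.Seg V S a a s t)
    (hs : ¬ s) : a ∈ G.Anc S := by
  obtain ⟨c, hc, hc'⟩ := h.exists_Dir hG hs
  exact mem_Anc_of_Dir hc (hG.mem_Anc_of_Dir_of_mem hc hc')

theorem proj_adj_iff (hv : G.verts = Set.univ) (hG : G.IsDAG) {a b : α} :
    (G.proj V S).skeleton.Adj a b ↔ a ∈ V ∧ b ∈ V ∧ a ≠ b ∧ ∃ s t, G.Seg V S a b s t := by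
  refine and_congr_right fun _ => and_congr_right fun _ => and_congr_right fun hab => ?_
  rw [hv, ← Set.compl_eq_univ_sdiff]
  exact exists_open_path_iff_trail hG.noUndirAtHead (ancClosed_Anc _) (subset_Anc _ (by simp)) hab

theorem proj_head_iff {a b : α} :
    (G.proj V S).head a b ↔ (G.proj V S).skeleton.Adj a b ∧ b ∉ G.Anc ({a} ∪ S) := Iff.rfl

theorem proj_notMem_Anc_of_head {a b : α} (h : (G.proj V S).head a b) : b ∉ G.Anc S :=
  fun hb => h.2 (Anc_mono Set.subset_union_right hb)

theorem proj_Undir_mem_Anc (hG : G.IsDAG) {a b : α} (h : (G.proj V S).skeleton.Adj a b)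
    (hab : ¬ (G.proj V S).head a b) (hba : ¬ (G.proj V S).head b a) : a ∈ G.Anc S := by
  simp only [proj_head_iff, h, h.symm, true_and, not_not, Anc_union] at hab hba
  obtain hba | hba := hba
  · obtain hab | hab := hab
    · exact absurd (hG.eq_of_mem_Anc hba hab) h.ne
    · exact mem_Anc_trans hba hab
  · exact hba

theorem proj_noUndirAtHead (hG : G.IsDAG) : (G.proj V S).NoUndirAtHead := by
  intro a b hba c hac
  by_contra! h
  exact proj_notMem_Anc_of_head hba (proj_Undir_mem_Anc hG hac h.2 h.1)

theorem proj_mem_Anc_of_Dir {a b : α} (h : (G.proj V S).Dir a b) : a ∈ G.Anc ({b} ∪ S) := by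
  by_contra k
  exact h.2 ⟨((G.proj V S).adj_of_head _ _ h.1).symm, k⟩

theorem proj_Anc_subset (A : Set α) : (G.proj V S).Anc A ⊆ G.Anc (A ∪ S) := by
  rintro v ⟨a, ha, h⟩
  induction h using Relation.ReflTransGen.head_induction_on with
  | refl => exact subset_Anc _ (.inl ha)
  | head h _ ih =>
    exact Anc_subset (Set.union_subset (by simpa using ih)
      (Set.subset_union_right.trans (subset_Anc _))) (proj_mem_Anc_of_Dir h)

theorem proj_notMem_Anc {a b : α} (h : (G.proj V S).head b a) : a ∉ (G.proj V S).Anc {b} :=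
  fun k => h.2 (proj_Anc_subset _ k)

theorem Seg.proj_adj (hv : G.verts = Set.univ) (hG : G.IsDAG) {a b : α} {s t : Prop}
    (h : G.Seg V S a b s t) (ha : a ∈ V) (hb : b ∈ V) (hab : a ≠ b) :
    (G.proj V S).skeleton.Adj a b :=
  (proj_adj_iff hv hG).2 ⟨ha, hb, hab, _, _, h⟩

theorem Seg.of_trail {a b : α} {s t : Prop} (h : G.Trail (V ∪ S)ᶜ (G.Anc S) a s b t) :
    G.Seg V S a b s t :=
  h.mono subset_rfl (Anc_mono Set.subset_union_right)

/-- Outside of the ancestors of `S`, ancestors within `V` remain ancestors in the projection, and a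
directed path from a vertex outside of `V` can be cut off at its first vertex `d` in `V`. -/
theorem mem_proj_Anc_aux (hv : G.verts = Set.univ) (hG : G.IsDAG) {B : Set α} (hB : B ⊆ V) {u : α}
    (hS : u ∉ G.Anc S) (h : u ∈ G.Anc B) :
    (u ∈ V → u ∈ (G.proj V S).Anc B) ∧ (u ∉ V → ∃ d ∈ V, d ∈ (G.proj V S).Anc B ∧
      ∃ s t, ¬ s ∧ t ∧ G.Trail (V ∪ S)ᶜ (G.Anc S) u s d t) := by
  obtain ⟨b, hb, h⟩ := h
  induction h using Relation.ReflTransGen.head_induction_on with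
  | refl => exact ⟨fun _ => subset_Anc _ hb, fun k => absurd (hB hb) k⟩
  | @head u w h h' ih =>
    have hadj := G.adj_of_head _ _ h.1
    have hwS : w ∉ G.Anc S := fun k => hS (mem_Anc_of_Dir h k)
    have key : ∃ d ∈ V, d ∉ G.Anc S ∧ d ∈ (G.proj V S).Anc B ∧
        ∃ s t, ¬ s ∧ t ∧ G.Trail (V ∪ S)ᶜ (G.Anc S) u s d t := by
      by_cases hw : w ∈ V
      · exact ⟨w, hw, hwS, (ih hwS).1 hw, _, _, h.2, h.1, .edge hadj⟩
      · obtain ⟨d, hd, hd', s, t, hs, ht, T⟩ := (ih hwS).2 hw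
        refine ⟨d, hd, ?_, hd', _, t, h.2, ht, .cons hadj ⟨fun _ => ?_, fun k => absurd k.2 hs⟩ T⟩
        · intro k
          have := (Seg.of_trail T).mem_Anc hG hs
          rw [Anc_union] at this
          exact this.elim (fun k' => hwS (mem_Anc_trans k' k)) hwS
        · rintro (k | k)
          exacts [hw k, hwS (subset_Anc _ k)]
    obtain ⟨d, hd, hdS, hdB, s, t, hs, ht, T⟩ := key
    refine ⟨fun hu => ?_, fun _ => ⟨d, hd, hdB, s, t, hs, ht, T⟩⟩
    have T' := Seg.of_trail T
    have hne : u ≠ d := by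
      rintro rfl
      exact hS (T'.mem_Anc_of_loop hG hs)
    have hud := T'.mem_Anc hG hs
    have hadj' := T'.proj_adj hv hG hu hd hne
    refine mem_Anc_of_Dir ⟨⟨hadj', ?_⟩, fun k => k.2 hud⟩ hdB
    rw [Anc_union]
    rintro (k | k)
    · rw [Anc_union] at hud
      exact hne (hG.eq_of_mem_Anc (hud.resolve_right hS) k)
    · exact hdS k

theorem mem_proj_Anc (hv : G.verts = Set.univ) (hG : G.IsDAG) {B : Set α} (hB : B ⊆ V) {u : α}
    (hu : u ∈ V) (hS : u ∉ G.Anc S) (h : u ∈ G.Anc B) : u ∈ (G.proj V S).Anc B :=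
  (mem_proj_Anc_aux hv hG hB hS h).1 hu

/-! ### Trails of a latent projection and of the graph -/

/-- If a trail of the projection leaves `x` through a tail, then `x` is an ancestor of a collider,
of the end of the trail, or of `S`. -/
theorem proj_mem_of_tail (hG : G.IsDAG) {N C A : Set α} (hA : G.AncClosed A) (hSA : S ⊆ A)
    (hCA : C ⊆ A) {x z : α} {s t : Prop} (h : (G.proj V S).Trail N C x s z t) (hz : z ∈ A)
    (hs : ¬ s) : x ∈ A := by
  have hAnc : ∀ B ⊆ A, G.Anc B ⊆ A := by
    rintro B hB v ⟨b, hb, h⟩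
    induction h using Relation.ReflTransGen.head_induction_on with
    | refl => exact hB hb
    | head h _ ih => exact hA _ _ h ih
  induction h with
  | @edge x y h =>
    simp only [proj_head_iff, h.symm, true_and, not_not] at hs
    exact hAnc _ (Set.union_subset (by simpa using hz) hSA) hs
  | @cons x y z s t h p T ih =>
    simp only [proj_head_iff, h.symm, true_and, not_not] at hs
    rw [Anc_union] at hs
    obtain hs | hs := hs
    · suffices hy : y ∈ A from hAnc _ (by simpa using hy) hs
      by_cases hs' : s
      · by_cases hxy : (G.proj V S).head x y
        · exact hCA (p.2 ⟨hxy, hs'⟩)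
        · simp only [proj_head_iff, h, true_and, not_not, Anc_union] at hxy
          obtain hxy | hxy := hxy
          · exact absurd (hG.eq_of_mem_Anc hs hxy) h.ne
          · exact hAnc _ hSA hxy
      · exact ih hz hs'
    · exact hAnc _ hSA hs

/-- All inner vertices of an open trail of the projection are ancestors of colliders, endpoints or
`S`. -/
theorem proj_trail_inter (hG : G.IsDAG) {N C A : Set α} (hA : G.AncClosed A) (hSA : S ⊆ A)
    (hCA : C ⊆ A) {x z : α} {s t : Prop} (h : (G.proj V S).Trail N C x s z t) (hx : x ∈ A)
    (hz : z ∈ A) : (G.proj V S).Trail (N ∩ A) C x s z t := by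
  induction h with
  | edge h => exact .edge h
  | @cons x y z s t h p T ih =>
    have hy : y ∈ A := by
      by_cases hxy : (G.proj V S).head x y
      · by_cases hs : s
        · exact hCA (p.2 ⟨hxy, hs⟩)
        · exact proj_mem_of_tail hG hA hSA hCA T hz hs
      · exact proj_mem_of_tail hG (N := N) (C := C) hA hSA hCA (.edge h.symm) hx hxy
    exact .cons h ⟨fun k => ⟨p.1 k, hy⟩, p.2⟩ (ih hy hz)

theorem exists_trail_of_proj_trail (hv : G.verts = Set.univ) (hG : G.IsDAG) (hVS : Disjoint V S)
    {N C A : Set α} (hA : G.AncClosed A) (hSA : G.Anc S ⊆ A) (hCA : C ⊆ A) (hNV : Vᶜ ⊆ N)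
    {x z : α} {s t : Prop}
    (h : (G.proj V S).Trail (N ∩ A) C x s z t) (hx : x ∈ A) (hz : z ∈ A) :
    ∃ s' t', G.Trail (N \ S) A x s' z t' ∧ (s → s') := by
  have hAnc : ∀ a ∈ A, G.Anc {a} ⊆ A := by
    rintro a ha v ⟨_, rfl, h⟩
    induction h using Relation.ReflTransGen.head_induction_on with
    | refl => exact ha
    | head h _ ih => exact hA _ _ h ih
  have hseg : ∀ {a b}, a ∈ A → b ∈ A → (G.proj V S).skeleton.Adj a b →
      ∃ s' t', G.Trail (N \ S) A a s' b t' ∧ ((G.proj V S).head b a → s') ∧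
        ((G.proj V S).head a b → t') := by
    intro a b ha hb hab
    obtain ⟨-, -, -, s', t', h⟩ := (proj_adj_iff hv hG).1 hab
    refine ⟨s', t', h.mono (fun v hv' => ⟨hNV fun k => hv' (.inl k), fun k => hv' (.inr k)⟩) ?_,
      fun k => ?_, fun k => ?_⟩
    · rw [Anc_union, Set.insert_eq, Anc_union]
      exact Set.union_subset (Set.union_subset (hAnc _ ha) (hAnc _ hb)) hSA
    · by_contra k'
      exact k.2 (h.mem_Anc hG k')
    · by_contra k'
      exact k.2 (h.symm.mem_Anc hG k')
  induction h with
  | @edge x y h =>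
    obtain ⟨s', t', h₁, h₂, -⟩ := hseg hx hz h
    exact ⟨s', t', h₁, h₂⟩
  | @cons x y z s t h p T ih =>
    have hy : y ∈ A := by
      by_cases k : (G.proj V S).head x y ∧ s
      exacts [hCA (p.2 k), (p.1 k).2]
    obtain ⟨u, u', h₁, h₂, h₃⟩ := hseg hx hy h
    obtain ⟨s', t', h₄, h₅⟩ := ih hy hz
    refine ⟨u, t', h₁.trans ⟨fun k => ⟨(p.1 fun k' => k ⟨h₃ k'.1, h₅ k'.2⟩).1, ?_⟩, fun _ => hy⟩ h₄,
      h₂⟩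
    exact Set.disjoint_left.1 hVS ((proj_adj_iff hv hG).1 h).2.1

end Projection
end MixedGraph

namespace MixedGraph

section Chain

variable {α : Type*} {G : MixedGraph α} {V S N A : Set α}

/-- `G.Chain V S N A z x y s`: the graph `G` has a chain of inducing trails `x, y, …, z` between
vertices in `V`, whose first mark is given by `s`, which may be run through at its inner vertices,
and which is reduced: consecutive vertices are distinct, and an inner vertex at which two arrowheads
meet is not an ancestor of `S` or of one of its two neighbors in the chain. -/
inductive Chain (G : MixedGraph α) (V S N A : Set α) (z : α) : α → α → Prop → Prop
  | seg {x : α} {s t : Prop} : x ∈ V → z ∈ V → x ≠ z → G.Seg V S x z s t → Chain G V S N A z x z s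
  | cons {x y w : α} {s m s' : Prop} : x ∈ V → x ≠ y → G.Seg V S x y s m → Pass N A m y s' →
      (m → s' → y ∉ G.Anc ({x, w} ∪ S)) → Chain G V S N A z y w s' → Chain G V S N A z x y s

theorem Chain.mem {z x y : α} {s : Prop} (h : G.Chain V S N A z x y s) : x ∈ V := by
  cases h <;> assumption

theorem Chain.exists_seg {z x y : α} {s : Prop} (h : G.Chain V S N A z x y s) :
    x ≠ y ∧ y ∈ V ∧ ∃ t, G.Seg V S x y s t := by
  cases h with
  | seg hx hz hxz h => exact ⟨hxz, hz, _, h⟩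
  | cons hx hxy h p hp T => exact ⟨hxy, T.mem, _, h⟩

/-- Two inducing trails that meet in a collider can be joined if the collider is an ancestor of the
other endpoints or of `S`. -/
theorem Seg.trans {x y w : α} {s m s' t : Prop} (h : G.Seg V S x y s m) (hm : m) (hs' : s')
    (hy : y ∈ G.Anc ({x, w} ∪ S)) (h' : G.Seg V S y w s' t) : G.Seg V S x w s t := by
  have hx : x ∈ G.Anc ({x, w} ∪ S) := subset_Anc _ (by simp)
  have hw : w ∈ G.Anc ({x, w} ∪ S) := subset_Anc _ (by simp)
  have hS : S ⊆ G.Anc ({x, w} ∪ S) := Set.subset_union_right.trans (subset_Anc _)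
  refine Trail.trans (h.mono subset_rfl (Anc_subset ?_)) ⟨fun k => absurd ⟨hm, hs'⟩ k, fun _ => hy⟩
    (h'.mono subset_rfl (Anc_subset ?_))
  · exact Set.union_subset (by simp [Set.insert_subset_iff, hx, hy]) hS
  · exact Set.union_subset (by simp [Set.insert_subset_iff, hw, hy]) hS

/-- An inducing trail can be put in front of a reduced chain: merge it with the first trail of the
chain where the junction violates the conditions, and drop it if it is a loop. The last clause says
that the new chain can replace the trail as the continuation of an earlier one. -/
theorem Chain.prepend (hG : G.IsDAG) (hSA : G.Anc S ⊆ A) {z y w : α} {s' : Prop}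
    (h : G.Chain V S N A z y w s') {x : α} {s m : Prop} (hx : x ∈ V) (hxy : G.Seg V S x y s m)
    (hp : Pass N A m y s') :
    ∃ s'', (x = z ∨ ∃ w', G.Chain V S N A z x w' s'') ∧ ∀ k, Pass N A k x s → Pass N A k x s'' := by
  have loop : ∀ {m s' : Prop} {y : α}, x = y → G.Seg V S x y s m → Pass N A m y s' →
      ∀ k, Pass N A k x s → Pass N A k x s' := by
    rintro m s' y rfl hxy hp k hk
    refine ⟨fun e => ?_, fun e => ?_⟩
    · by_cases hs' : s'
      · exact hk.1 fun e' => e ⟨e'.1, hs'⟩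
      · exact hp.1 fun e' => hs' e'.2
    · by_cases hs : s
      · exact hk.2 ⟨e.1, hs⟩
      · exact hSA (hxy.mem_Anc_of_loop hG hs)
  induction h generalizing m with
  | @seg y s' t hy hz hyz h =>
    by_cases hne : x = y
    · exact ⟨s', .inr ⟨z, hne ▸ .seg hy hz hyz h⟩, loop hne hxy hp⟩
    by_cases hbad : m ∧ s' ∧ y ∈ G.Anc ({x, z} ∪ S)
    · refine ⟨s, ?_, fun _ => id⟩
      by_cases hxz : x = z
      · exact .inl hxz
      · exact .inr ⟨z, .seg hx hz hxz (hxy.trans hbad.1 hbad.2.1 hbad.2.2 h)⟩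
    · exact ⟨s, .inr ⟨y, .cons hx hne hxy hp (fun a b c => hbad ⟨a, b, c⟩) (.seg hy hz hyz h)⟩,
        fun _ => id⟩
  | @cons y w w₂ s' m₂ s₂ hy hyw h p hw T ih =>
    by_cases hne : x = y
    · exact ⟨s', .inr ⟨w, hne ▸ .cons hy hyw h p hw T⟩, loop hne hxy hp⟩
    by_cases hbad : m ∧ s' ∧ y ∈ G.Anc ({x, w} ∪ S)
    · exact ih (hxy.trans hbad.1 hbad.2.1 hbad.2.2 h) p
    · exact ⟨s, .inr ⟨y, .cons hx hne hxy hp (fun a b c => hbad ⟨a, b, c⟩)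
        (.cons hy hyw h p hw T)⟩, fun _ => id⟩

/-- The trail of the projection along a reduced chain. -/
theorem Chain.trail (hv : G.verts = Set.univ) (hG : G.IsDAG) {B : Set α} (hB : B ⊆ V)
    {z x y : α} {s : Prop} (h : G.Chain V S N (G.Anc (B ∪ S)) z x y s) :
    ∃ t, (G.proj V S).Trail N ((G.proj V S).Anc B) x ((G.proj V S).head y x) z t := by
  induction h with
  | seg hx hz hxz h => exact ⟨_, .edge (h.proj_adj hv hG hx hz hxz)⟩
  | @cons x y w s m s' hx hxy h p hp T ih =>
    obtain ⟨t, ht⟩ := ih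
    obtain ⟨hyw, hw, _, h'⟩ := T.exists_seg
    have hadj := h.proj_adj hv hG hx T.mem hxy
    have hadj' := h'.proj_adj hv hG T.mem hw hyw
    refine ⟨t, .cons hadj ⟨fun k => p.1 fun k' => k ?_, fun k => ?_⟩ ht⟩
    · have := hp k'.1 k'.2
      exact ⟨⟨hadj, fun e => this (Anc_mono (Set.union_subset_union_left _ (by simp)) e)⟩,
        ⟨hadj'.symm, fun e => this (Anc_mono (Set.union_subset_union_left _ (by simp)) e)⟩⟩
    · have hm : m := by
        by_contra hm
        exact k.1.2 (h.symm.mem_Anc hG hm)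
      have hs' : s' := by
        by_contra hs'
        exact k.2.2 (h'.mem_Anc hG hs')
      have hy := p.2 ⟨hm, hs'⟩
      have hyS := proj_notMem_Anc_of_head k.1
      rw [Anc_union] at hy
      exact mem_proj_Anc hv hG hB T.mem hyS (hy.resolve_right hyS)

/-- The chain of inducing trails along an open trail of `G`: colliders outside of `V` that are not
ancestors of `S` are replaced by their first descendants in `V`. -/
theorem Trail.exists_chain (hv : G.verts = Set.univ) (hG : G.IsDAG) {B : Set α} (hB : B ⊆ V)
    {x z : α} {s t : Prop} (h : G.Trail (N \ S) (G.Anc (B ∪ S)) x s z t) (hz : z ∈ V) :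
    (∃ y ∈ V, ∃ m, G.Trail (V ∪ S)ᶜ (G.Anc S) x s y m ∧ (y = z ∨ ∃ w s',
      G.Chain V S N (G.Anc (B ∪ S)) z y w s' ∧ Pass N (G.Anc (B ∪ S)) m y s')) ∧
    (x ∈ V → ∃ s', (x = z ∨ ∃ w, G.Chain V S N (G.Anc (B ∪ S)) z x w s') ∧
      ∀ k, Pass N (G.Anc (B ∪ S)) k x s → Pass N (G.Anc (B ∪ S)) k x s') := by
  have hSA : G.Anc S ⊆ G.Anc (B ∪ S) := Anc_mono Set.subset_union_right
  have second : ∀ {x : α} {s : Prop}, x ∈ V →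
      (∃ y ∈ V, ∃ m, G.Trail (V ∪ S)ᶜ (G.Anc S) x s y m ∧ (y = z ∨ ∃ w s',
        G.Chain V S N (G.Anc (B ∪ S)) z y w s' ∧ Pass N (G.Anc (B ∪ S)) m y s')) →
      ∃ s', (x = z ∨ ∃ w, G.Chain V S N (G.Anc (B ∪ S)) z x w s') ∧
        ∀ k, Pass N (G.Anc (B ∪ S)) k x s → Pass N (G.Anc (B ∪ S)) k x s' := by
    rintro x s hx ⟨y, hy, m, hxy, rfl | ⟨w, s', h', hp⟩⟩
    · refine ⟨s, ?_, fun _ => id⟩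
      by_cases hne : x = y
      · exact .inl hne
      · exact .inr ⟨_, .seg hx hz hne (.of_trail hxy)⟩
    · exact h'.prepend hG hSA hx (.of_trail hxy) hp
  suffices H : ∃ y ∈ V, ∃ m, G.Trail (V ∪ S)ᶜ (G.Anc S) x s y m ∧ (y = z ∨ ∃ w s',
      G.Chain V S N (G.Anc (B ∪ S)) z y w s' ∧ Pass N (G.Anc (B ∪ S)) m y s') from
    ⟨H, fun hx => second hx H⟩
  induction h with
  | edge h => exact ⟨_, hz, _, .edge h, .inl rfl⟩
  | @cons x u z s t h p T ih =>
    have ih := ih hz second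
    by_cases hu : u ∈ V
    · obtain ⟨s', h', hs'⟩ := second hu ih
      refine ⟨u, hu, _, .edge h, h'.imp_right fun ⟨w, hw⟩ => ⟨w, s', hw, ?_⟩⟩
      exact hs' _ (p.mono Set.sdiff_subset subset_rfl)
    · obtain ⟨y, hy, m, T', h'⟩ := ih
      by_cases hbad : (G.head x u ∧ s) ∧ u ∉ G.Anc S
      · -- the trail takes a detour from `u` to its first descendant `d` in `V` and back
        obtain ⟨k, huS⟩ := hbad
        have huB : u ∈ G.Anc B := by
          have := p.2 k
          rw [Anc_union] at this
          exact this.resolve_right huS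
        obtain ⟨d, hd, hdB, a, b, ha, hb, T''⟩ := (mem_proj_Anc_aux hv hG hB huS huB).2 hu
        have huN : u ∈ (V ∪ S)ᶜ := by
          rintro (k | k)
          exacts [hu k, huS (subset_Anc _ k)]
        have hdy : G.Trail (V ∪ S)ᶜ (G.Anc S) d b y m :=
          T''.symm.trans ⟨fun _ => huN, fun k => absurd k.1 ha⟩ T'
        obtain ⟨s', h₁, h₂⟩ := second hd ⟨y, hy, m, hdy, h'⟩
        refine ⟨d, hd, b, .cons h ⟨fun _ => huN, fun k => absurd k.2 ha⟩ T'',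
          h₁.imp_right fun ⟨w, hw⟩ => ⟨w, s', hw, h₂ b ?_⟩⟩
        exact ⟨fun k => absurd ⟨hb, hb⟩ k, fun _ => proj_Anc_subset _ hdB⟩
      · refine ⟨y, hy, m, .cons h ⟨fun k => ?_, fun k => ?_⟩ T', h'⟩
        · rintro (k' | k')
          exacts [hu k', (p.1 k).2 k']
        · by_contra k'
          exact hbad ⟨k, k'⟩

/-- The latent projection represents the separations of `G` given `S`. -/
theorem proj_MSep_iff (hv : G.verts = Set.univ) (hG : G.IsDAG) (hVS : Disjoint V S) {x z : α}
    (hx : x ∈ V) (hz : z ∈ V) {W : Set α} (hW : W ⊆ V) :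
    (G.proj V S).MSep x z W ↔ G.MSep x z (W ∪ S) := by
  by_cases hxz : x = z
  · subst hxz
    exact iff_of_false (MSep_self _ _) (MSep_self _ _)
  rw [← not_iff_not, not_MSep_iff (proj_noUndirAtHead hG) hxz, not_MSep_iff hG.noUndirAtHead hxz,
    ← Set.union_assoc]
  have hB : {x, z} ∪ W ⊆ V := Set.union_subset (by simp [Set.insert_subset_iff, hx, hz]) hW
  have hN : (W ∪ S)ᶜ = Wᶜ \ S := by rw [Set.compl_union]; rfl
  have hSA : G.Anc S ⊆ G.Anc ({x, z} ∪ W ∪ S) := Anc_mono Set.subset_union_right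
  have hxA : x ∈ G.Anc ({x, z} ∪ W ∪ S) := subset_Anc _ (by simp)
  have hzA : z ∈ G.Anc ({x, z} ∪ W ∪ S) := subset_Anc _ (by simp)
  rw [hN]
  constructor
  · rintro ⟨s, t, h⟩
    obtain ⟨s', t', h', -⟩ := exists_trail_of_proj_trail hv hG hVS (ancClosed_Anc _) hSA
      (proj_Anc_subset _) (Set.compl_subset_compl.2 hW)
      (proj_trail_inter hG (ancClosed_Anc _) ((subset_Anc _).trans hSA) (proj_Anc_subset _) h
        hxA hzA) hxA hzA
    exact ⟨s', t', h'⟩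
  · rintro ⟨s, t, h⟩
    obtain ⟨s', h' | ⟨w, h'⟩, -⟩ := (h.exists_chain hv hG hB hz).2 hx
    · exact absurd h' hxz
    · obtain ⟨t', h''⟩ := h'.trail hv hG hB
      exact ⟨_, t', h''⟩

/-- Maximality: vertices are adjacent in the latent projection if and only if they cannot be
separated. -/
theorem proj_adj_iff_forall_not_MSep (hv : G.verts = Set.univ) (hG : G.IsDAG) {x z : α}
    (hx : x ∈ V) (hz : z ∈ V) (hxz : x ≠ z) :
    (G.proj V S).skeleton.Adj x z ↔ ∀ W ⊆ V \ {x, z}, ¬ G.MSep x z (W ∪ S) := by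
  rw [proj_adj_iff hv hG]
  constructor
  · rintro ⟨-, -, -, s, t, h⟩ W hW
    rw [not_MSep_iff hG.noUndirAtHead hxz]
    exact ⟨s, t, h.mono (Set.compl_subset_compl.2 (Set.union_subset_union_left _
      (hW.trans Set.sdiff_subset))) (Anc_mono (Set.union_subset_union_right _
      Set.subset_union_right))⟩
  · intro h
    -- the ancestors of the endpoints and of `S` separate them if anything does
    have := h ((V ∩ G.Anc ({x, z} ∪ S)) \ {x, z}) (Set.sdiff_subset_sdiff_left Set.inter_subset_left)
    rw [not_MSep_iff hG.noUndirAtHead hxz] at this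
    obtain ⟨s, t, h⟩ := this
    have hzA : z ∈ G.Anc ({x, z} ∪ S) := subset_Anc _ (by simp)
    obtain ⟨s, t, h⟩ := ((h.mono subset_rfl (Anc_subset (Set.union_subset
      (Set.subset_union_left.trans (subset_Anc _)) (Set.union_subset
      (Set.sdiff_subset.trans Set.inter_subset_right)
      (Set.subset_union_right.trans (subset_Anc _)))))).inter_of_isDAG hG (ancClosed_Anc _)
      (subset_Anc _ (by simp)) hzA).exists_diff_endpoints hG.noUndirAtHead (ancClosed_Anc _) hzA hxz
    refine ⟨hx, hz, hxz, s, t, h.mono ?_ subset_rfl⟩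
    rintro v ⟨⟨hv₁, hv₂⟩, hv₃⟩ (k | k)
    · exact hv₁ (.inl ⟨⟨k, hv₂⟩, hv₃⟩)
    · exact hv₁ (.inr k)

/-- `G.Inducing U x z`: there is an open trail between `x` and `z` whose inner non-colliders are
outside of `U` and whose inner colliders are ancestors of `x` or `z`. -/
def Inducing (G : MixedGraph α) (U : Set α) (x z : α) : Prop :=
  ∃ s t, G.Trail Uᶜ (G.Anc {x, z}) x s z t

/-- Two vertices can be separated by a subset of `U ⊆ V` unless the projection has an inducing trail
relative to `U`. -/
theorem forall_not_MSep_iff_inducing (hv : G.verts = Set.univ) (hG : G.IsDAG) (hVS : Disjoint V S)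
    {U : Set α} (hU : U ⊆ V) {x z : α} (hx : x ∈ V) (hz : z ∈ V) (hxz : x ≠ z) :
    (∀ W ⊆ U \ {x, z}, ¬ G.MSep x z (W ∪ S)) ↔ (G.proj V S).Inducing U x z := by
  have hM := proj_noUndirAtHead (V := V) (S := S) hG
  constructor
  · intro h
    have hsub : (U ∩ G.Anc ({x, z} ∪ S)) \ {x, z} ⊆ U \ {x, z} :=
      Set.sdiff_subset_sdiff_left Set.inter_subset_left
    have := h _ hsub
    rw [← proj_MSep_iff hv hG hVS hx hz (hsub.trans (Set.sdiff_subset.trans hU)),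
      not_MSep_iff hM hxz] at this
    obtain ⟨s, t, h⟩ := this
    have hCA : (G.proj V S).Anc ({x, z} ∪ (U ∩ G.Anc ({x, z} ∪ S)) \ {x, z}) ⊆
        G.Anc ({x, z} ∪ S) := by
      refine (proj_Anc_subset _).trans (Anc_subset (Set.union_subset (Set.union_subset
        (Set.subset_union_left.trans (subset_Anc _))
        (Set.sdiff_subset.trans Set.inter_subset_right))
        (Set.subset_union_right.trans (subset_Anc _))))
    have hA : x ∈ G.Anc ({x, z} ∪ S) := subset_Anc _ (by simp)
    have hA' : z ∈ G.Anc ({x, z} ∪ S) := subset_Anc _ (by simp)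
    have h' := (proj_trail_inter hG (ancClosed_Anc _)
      (Set.subset_union_right.trans (subset_Anc _)) hCA h hA hA').refine_sets
    have hz' : z ∈ (G.proj V S).Anc {x, z} := subset_Anc _ (by simp)
    obtain ⟨s, t, h''⟩ := (h'.mono (C' := (G.proj V S).Anc {x, z}) subset_rfl (by
      rintro c ⟨hc, w, hw⟩
      have hcS := proj_notMem_Anc_of_head hw
      have := hCA hc
      rw [Anc_union] at this
      exact mem_proj_Anc hv hG (by simp [Set.insert_subset_iff, hx, hz])
        ((G.proj V S).mem_of_adj _ _ ((G.proj V S).adj_of_head _ _ hw).symm) hcS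
        (this.resolve_right hcS))).exists_diff_endpoints hM (ancClosed_Anc _) hz' hxz
    refine ⟨s, t, h''.mono ?_ subset_rfl⟩
    rintro v ⟨⟨⟨hv₁, hv₂⟩, -⟩, hv₃⟩ k
    exact hv₁ ⟨⟨k, hv₂⟩, hv₃⟩
  · rintro ⟨s, t, h⟩ W hW
    rw [← proj_MSep_iff hv hG hVS hx hz (hW.trans (Set.sdiff_subset.trans hU)), not_MSep_iff hM hxz]
    exact ⟨s, t, h.mono (Set.compl_subset_compl.2 (hW.trans Set.sdiff_subset))
      (Anc_mono Set.subset_union_left)⟩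

end Chain
end MixedGraph

namespace MixedGraph

/-! ### Removable vertices of a latent projection -/

section Removable

variable {α : Type*} {G : MixedGraph α} {V S : Set α}

theorem induce_noUndirAtHead {A : Set α} (hG : G.NoUndirAtHead) : (G.induce A).NoUndirAtHead :=
  fun a b h c hc => (hG a b h.1 c hc.1).imp (fun k => ⟨k, hc.2.2, hc.2.1⟩) fun k => ⟨k, hc.2⟩

theorem eq_of_adj_iff_of_head_iff {H : MixedGraph α} (hv : G.verts = H.verts)
    (hadj : ∀ a b, G.skeleton.Adj a b ↔ H.skeleton.Adj a b)
    (hhead : ∀ a b, G.head a b ↔ H.head a b) : G = H := by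
  have h₁ : G.skeleton = H.skeleton := by
    ext a b
    exact hadj a b
  have h₂ : G.head = H.head := by
    ext a b
    exact hhead a b
  cases G
  cases H
  simp_all

/-- A vertex `X` is removable if and only if its marginalization creates no new adjacencies. -/
theorem proj_removable_iff (hv : G.verts = Set.univ) (hG : G.IsDAG) (hVS : Disjoint V S) {X : α}
    (hX : X ∈ V) : (G.proj V S).Removable X ↔ ∀ Y ∈ V \ {X}, ∀ Z ∈ V \ {X}, Y ≠ Z →
      (G.proj V S).Inducing (V \ {X}) Y Z → (G.proj V S).skeleton.Adj Y Z := by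
  have hM := proj_noUndirAtHead (V := V) (S := S) hG
  constructor
  · rintro ⟨-, h⟩ Y hY Z hZ hYZ hind
    by_contra hadj
    rw [proj_adj_iff_forall_not_MSep hv hG hY.1 hZ.1 hYZ] at hadj
    push Not at hadj
    obtain ⟨W, hW, hsep⟩ := hadj
    -- a set that separates `Y` and `Z` does so without `X` after the removal of `X`
    have hsep' : ((G.proj V S).induce (V \ {X})).MSep Y Z (W \ {X}) := by
      rw [← proj_MSep_iff hv hG hVS hY.1 hZ.1 (hW.trans Set.sdiff_subset)] at hsep
      contrapose! hsep
      rw [not_MSep_iff (induce_noUndirAtHead hM) hYZ] at hsep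
      rw [not_MSep_iff hM hYZ]
      obtain ⟨s, t, hsep⟩ := hsep
      refine ⟨s, t, hsep.map (fun a b h => h.1) (fun a b h => ⟨fun k => k.1, fun k => ⟨k, h.2⟩⟩)
        ?_ ?_⟩
      · rintro v ⟨hv, -, -, hvX⟩ k
        exact hv ⟨k, hvX⟩
      · rintro v ⟨⟨a, ha, h⟩, -⟩
        exact ⟨a, ha.imp_right fun k => k.1,
          h.lift id fun a b k => ⟨k.1.1, fun k' => k.2 ⟨k', k.1.2.symm⟩⟩⟩
    have hWX : W \ {X} ⊆ (V \ {X}) \ {Y, Z} := fun v hv => ⟨⟨(hW hv.1).1, hv.2⟩, (hW hv.1).2⟩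
    have hsep := (h Y hY Z hZ (W \ {X}) fun v hv =>
      ⟨(hW hv.1).1, fun k => k.elim hv.2 (hW hv.1).2⟩).2 hsep'
    rw [proj_MSep_iff hv hG hVS hY.1 hZ.1 (hWX.trans (Set.sdiff_subset.trans Set.sdiff_subset))]
      at hsep
    exact (forall_not_MSep_iff_inducing hv hG hVS Set.sdiff_subset hY.1 hZ.1 hYZ).2 hind _ hWX hsep
  · intro h
    -- the induced subgraph is a latent projection as well
    have hadj : ∀ a b, ((G.proj V S).induce (V \ {X})).skeleton.Adj a b ↔
        (G.proj (V \ {X}) S).skeleton.Adj a b := by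
      intro a b
      constructor
      · rintro ⟨hab, ha, hb⟩
        have hne := hab.ne
        rw [proj_adj_iff_forall_not_MSep hv hG ha.1 hb.1 hne] at hab
        rw [proj_adj_iff_forall_not_MSep hv hG ha hb hne]
        exact fun W hW => hab W (hW.trans (Set.sdiff_subset_sdiff_left Set.sdiff_subset))
      · intro hab
        obtain ⟨ha, hb, hne, -⟩ := (proj_adj_iff hv hG).1 hab
        refine ⟨h a ha b hb hne ?_, ha, hb⟩
        rw [proj_adj_iff_forall_not_MSep hv hG ha hb hne] at hab
        exact (forall_not_MSep_iff_inducing hv hG hVS Set.sdiff_subset ha.1 hb.1 hne).1 hab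
    have heq : (G.proj V S).induce (V \ {X}) = G.proj (V \ {X}) S := by
      refine eq_of_adj_iff_of_head_iff ?_ hadj fun a b => ?_
      · exact Set.inter_eq_right.2 Set.sdiff_subset
      · rw [proj_head_iff, ← hadj]
        exact ⟨fun k => ⟨⟨k.1.1, k.2⟩, k.1.2⟩, fun k => ⟨⟨k.1.1, k.2⟩, k.1.2⟩⟩
    refine ⟨hX, fun Y hY W hW Z hZ => ?_⟩
    change Y ∈ V \ {X} at hY
    change W ∈ V \ {X} at hW
    change Z ⊆ V \ {X, Y, W} at hZ
    change _ ↔ ((G.proj V S).induce (V \ {X})).MSep Y W Z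
    rw [heq, proj_MSep_iff hv hG hVS hY.1 hW.1 (hZ.trans Set.sdiff_subset),
      proj_MSep_iff hv hG (hVS.mono_left Set.sdiff_subset) hY hW
        fun v hv => ⟨(hZ hv).1, fun k => (hZ hv).2 (.inl k)⟩]

end Removable
end MixedGraph

/-- A consequence of chordality, which is equivalent to it in finite graphs: if two sets of vertices
without edges between them both connect `y` to `z`, then `y` and `z` are adjacent. -/
def SimpleGraph.CliqueSeparators {α : Type*} (H : SimpleGraph α) : Prop :=
  ∀ (K J : Set α) (y z : α), Disjoint K J → (∀ k ∈ K, ∀ j ∈ J, ¬ H.Adj k j) → y ∉ K ∪ J →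
    z ∉ K ∪ J → y ≠ z → (∃ p : H.Walk y z, ∀ v ∈ p.support, v ∈ K ∪ {y, z}) →
    (∃ p : H.Walk y z, ∀ v ∈ p.support, v ∈ J ∪ {y, z}) → H.Adj y z

namespace MixedGraph

/-! ### Maximal ancestral graphs -/

section MAG

variable {α : Type*} {M : MixedGraph α}

/-- A maximal ancestral graph: there are no directed or almost directed cycles, arrowheads do not
meet undirected edges, and only adjacent vertices are joined by an inducing trail. -/
structure IsMAG (M : MixedGraph α) : Prop where
  noUndirAtHead : M.NoUndirAtHead
  notMem_Anc : ∀ a b, M.head b a → a ∉ M.Anc {b}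
  adj_of_inducing : ∀ a b, a ≠ b → M.Inducing M.verts a b → M.skeleton.Adj a b

theorem proj_isMAG {G : MixedGraph α} {V S : Set α} (hv : G.verts = Set.univ) (hG : G.IsDAG)
    (hVS : Disjoint V S) : (G.proj V S).IsMAG where
  noUndirAtHead := proj_noUndirAtHead hG
  notMem_Anc _ _ h := proj_notMem_Anc h
  adj_of_inducing a b hab h := by
    have ha : a ∈ V := by
      obtain ⟨s, t, h⟩ := h
      exact h.mem_left
    have hb : b ∈ V := by
      obtain ⟨s, t, h⟩ := h
      exact h.symm.mem_left
    rw [proj_adj_iff_forall_not_MSep hv hG ha hb hab]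
    exact (forall_not_MSep_iff_inducing hv hG hVS subset_rfl ha hb hab).2 h

theorem Inducing.of_adj {U : Set α} {a b : α} (h : M.skeleton.Adj a b) : M.Inducing U a b :=
  ⟨_, _, .edge h⟩

namespace IsMAG

theorem adj_of_trail (hM : M.IsMAG) {a b : α} {s t : Prop} (hab : a ≠ b)
    (h : M.Trail ∅ (M.Anc {a, b}) a s b t) : M.skeleton.Adj a b :=
  hM.adj_of_inducing a b hab ⟨s, t, h.mono (Set.empty_subset _) subset_rfl⟩

theorem head_of_not_head (hM : M.IsMAG) {a b c : α} (ha : M.head c a) (hab : M.skeleton.Adj a b)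
    (h : ¬ M.head b a) : M.head a b :=
  (hM.noUndirAtHead a c ha b hab).resolve_left h

theorem eq_of_mem_Anc (hM : M.IsMAG) {a b : α} (hab : a ∈ M.Anc {b}) (hba : b ∈ M.Anc {a}) :
    a = b := by
  obtain ⟨_, rfl, hab⟩ := hab
  obtain rfl | ⟨c, hc, hc'⟩ := hab.cases_head
  · rfl
  · exact absurd (mem_Anc_trans ⟨_, rfl, hc'⟩ hba) (hM.notMem_Anc _ _ hc.1)

theorem mem_Anc_of_Dir_of_mem_pair (hM : M.IsMAG) {a b c : α} (hac : M.Dir a c)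
    (hc : c ∈ M.Anc {a, b}) : a ∈ M.Anc {b} := by
  rw [Set.insert_eq, Anc_union] at hc
  exact mem_Anc_of_Dir hac (hc.resolve_left (hM.notMem_Anc _ _ hac.1))

end IsMAG

theorem exists_head_of_mem_Anc {a b : α} (h : a ∈ M.Anc {b}) (hab : a ≠ b) : ∃ w, M.head w b := by
  obtain ⟨_, rfl, h⟩ := h
  obtain rfl | ⟨c, -, hc⟩ := h.cases_tail
  · exact absurd rfl hab
  · exact ⟨c, hc.1⟩

/-- Between vertices without arrowheads, an inducing trail consists of undirected edges. -/
theorem Trail.exists_undirected_walk {N : Set α} (hM : M.NoUndirAtHead) {y z : α} {s t : Prop}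
    (hy : ∀ w, ¬ M.head w y) (hz : ∀ w, ¬ M.head w z) (h : M.Trail N (M.Anc {y, z}) y s z t) :
    ∃ p : M.undirected.Walk y z, ∀ v ∈ p.support, v ∈ N ∪ {y, z} := by
  have h' : M.Trail N ∅ y s z t := by
    refine h.refine_sets.mono Set.inter_subset_left ?_
    rintro c ⟨hc, w, hw⟩
    rw [Set.insert_eq, Anc_union] at hc
    obtain hc | hc := hc
    · by_cases e : c = y
      · exact hy w (e ▸ hw)
      · exact (exists_head_of_mem_Anc hc e).elim hy
    · by_cases e : c = z
      · exact hz w (e ▸ hw)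
      · exact (exists_head_of_mem_Anc hc e).elim hz
  clear h
  induction h' with
  | @edge y z h =>
    have e : M.undirected.Adj y z := ⟨h, hz _, hy _⟩
    exact ⟨.cons e .nil, by simp⟩
  | @cons y u z s t h p T ih =>
    have hyu : ¬ M.head y u := by
      intro k
      by_cases hs : s
      · exact p.2 ⟨k, hs⟩
      · obtain ⟨c, hc, rfl⟩ := (T.mono subset_rfl (Set.empty_subset {z})).exists_Dir hM
          (by rintro a b hab rfl; exact (hz _ hab.1).elim) rfl (hM _ _ k) hs
        exact hz _ hc.1
    have hu : ∀ w, ¬ M.head w u := fun w hw => (hM _ _ hw _ h.symm).elim hyu (hy u)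
    obtain ⟨q, hq⟩ := ih hu hz
    have e : M.undirected.Adj y u := ⟨h, hyu, hy u⟩
    refine ⟨.cons e q, fun v hv => ?_⟩
    rw [SimpleGraph.Walk.support_cons, List.mem_cons] at hv
    obtain rfl | hv := hv
    · simp
    · obtain hv | rfl | rfl := hq v hv
      · exact .inl hv
      · exact .inl (p.1 fun k => hyu k.1)
      · simp

end MAG

/-! ### The local criterion for removability -/

section Criterion

variable {α : Type*} {M : MixedGraph α} {X : α} {B : Set α}

/-- Let `B` contain every vertex that is reached from `X` by a walk whose inner vertices are
colliders. If the non-colliders of a trail are outside of `B`, and the trail starts in `X` or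
continues such a walk, then its only non-collider is `X`. -/
theorem Trail.inter_singleton {N C : Set α}
    (hB : ∀ u s t, M.Trail ∅ Set.univ X s u t → u ≠ X → u ∈ B) (hN : Disjoint N B)
    {u z : α} {s t : Prop} (h : M.Trail N C u s z t)
    (hu : u = X ∨ (∃ r m, m ∧ M.Trail ∅ Set.univ X r u m) ∧ s) : M.Trail (N ∩ {X}) C u s z t := by
  induction h with
  | edge h => exact .edge h
  | @cons u y z s t h p T ih =>
    have hy : ∃ r, M.Trail ∅ Set.univ X r y (M.head u y) := by
      obtain rfl | ⟨⟨r, m, hm, hu⟩, hs⟩ := hu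
      · exact ⟨_, .edge h⟩
      · exact ⟨r, hu.trans ⟨fun k => absurd ⟨hm, hs⟩ k, fun _ => trivial⟩ (.edge h)⟩
    obtain ⟨r, hy⟩ := hy
    by_cases hyX : y = X
    · exact .cons h ⟨fun k => ⟨p.1 k, hyX⟩, p.2⟩ (ih (.inl hyX))
    · have hcol : M.head u y ∧ s := by
        by_contra k
        exact Set.disjoint_left.1 hN (p.1 k) (hB _ _ _ hy hyX)
      exact .cons h ⟨fun k => absurd hcol k, p.2⟩ (ih (.inr ⟨⟨r, _, hcol.1, hy⟩, hcol.2⟩))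

/-- If the marginalization of `X` creates no new adjacencies among the vertices of `M`, then it does
not create any relative to `B`. -/
theorem Inducing.insert_of_removable {V : Set α}
    (hB : ∀ u s t, M.Trail ∅ Set.univ X s u t → u ≠ X → u ∈ B) {Y Z : α}
    (hadj : M.Inducing (V \ {X}) Y Z → M.skeleton.Adj Y Z) (h : M.Inducing B Y Z) :
    M.Inducing (B ∪ {X}) Y Z := by
  obtain ⟨s, t, h⟩ := h
  obtain h | ⟨m, m', hm, h₁, h₂⟩ := h.split X
  · exact ⟨s, t, h.mono (fun v hv k => k.elim hv.1 hv.2) subset_rfl⟩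
  · have hd : Disjoint Bᶜ B := disjoint_compl_left
    have h₁' := h₁.symm.inter_singleton hB (hd.mono_left Set.sdiff_subset) (.inl rfl)
    have h₂' := h₂.inter_singleton hB hd (.inl rfl)
    have hN : Bᶜ ∩ {X} ⊆ (V \ {X})ᶜ := fun v hv k => k.2 hv.2
    refine .of_adj (hadj ⟨s, t, (h₁'.symm.mono ?_ subset_rfl).trans ⟨fun _ k => k.2 rfl,
      fun k => absurd k hm⟩ (h₂'.mono hN subset_rfl)⟩)
    rintro v ⟨⟨hv, hv'⟩, hv''⟩
    exact absurd hv'' hv'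

/-- Under the local criterion, a child `Z` of `X` is adjacent to each vertex `Y` that is reached
from `X` through colliders that are ancestors of `Y` or `Z`. -/
theorem adj_of_criterion (hM : M.IsMAG) (hXB : X ∉ B)
    (hB : ∀ u s t, M.Trail ∅ Set.univ X s u t → u ≠ X → u ∈ B)
    (hT : ∀ Y, M.skeleton.Adj X Y → ∀ Z ∈ B, Z ≠ Y → M.Inducing B Y Z → M.Inducing (B ∪ {X}) Y Z)
    {Y Z : α} (hXZ : M.Dir X Z) {s t : Prop} (h : M.Trail ∅ (M.Anc {Y, Z}) X s Y t)
    (hYZ : Y ≠ Z) (hYX : Y ≠ X) : M.skeleton.Adj Y Z := by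
  have hadj := M.adj_of_head _ _ hXZ.1
  have hYB : Y ∈ B := hB Y s t (h.mono subset_rfl (Set.subset_univ _)) hYX
  -- the trail from `Y` to `Z` through `X` is inducing relative to `B`
  obtain ⟨u, v, h'⟩ := hT Z hadj Y hYB hYZ ⟨_, _, .cons hadj.symm
    ⟨fun _ => hXB, fun k => absurd k.1 hXZ.2⟩
    (h.mono (Set.empty_subset _) (by rw [Set.pair_comm]))⟩
  have hd : Disjoint (B ∪ {X})ᶜ B := disjoint_compl_left.mono_right Set.subset_union_left
  -- an arrowhead at a child of `X` forces all inner vertices of an inducing trail to be colliders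
  have force : ∀ {Y Z : α} {u v : Prop}, Y ≠ Z → M.Dir X Z →
      M.Trail (B ∪ {X})ᶜ (M.Anc {Z, Y}) Z u Y v → u → M.skeleton.Adj Z Y := by
    intro Y Z u v hYZ hXZ h' hu
    refine hM.adj_of_trail hYZ.symm ((h'.inter_singleton hB hd (.inr ⟨⟨_, _, hXZ.1,
      .edge (M.adj_of_head _ _ hXZ.1)⟩, hu⟩)).mono ?_ subset_rfl)
    rintro w ⟨hw, hw'⟩
    exact hw (.inr hw')
  have anc : ∀ {Y Z : α} {u v : Prop}, M.Dir X Z →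
      M.Trail (B ∪ {X})ᶜ (M.Anc {Z, Y}) Z u Y v → ¬ u → Z ∈ M.Anc {Y} := by
    intro Y Z u v hXZ h' hu
    obtain ⟨c, hc, hc'⟩ := h'.exists_Dir hM.noUndirAtHead (ancClosed_Anc _)
      (subset_Anc _ (by simp)) (hM.noUndirAtHead _ _ hXZ.1) hu
    exact hM.mem_Anc_of_Dir_of_mem_pair hc hc'
  by_cases hu : u
  · exact (force hYZ hXZ h' hu).symm
  have hZY := anc hXZ h' hu
  have hXY : M.Dir X Y := by
    cases h.symm with
    | edge hadj' =>
      have hYX : ¬ M.head Y X := fun k => hM.notMem_Anc _ _ k (mem_Anc_of_Dir hXZ hZY)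
      obtain ⟨w, hw⟩ := exists_head_of_mem_Anc hZY hYZ.symm
      exact ⟨(hM.noUndirAtHead _ _ hw _ hadj').resolve_right hYX, hYX⟩
    | cons _ p _ =>
      have k := p.collider
      exact absurd (Anc_subset (by simp [Set.insert_subset_iff, hZY, subset_Anc {Y} rfl]) (p.2 k))
        (hM.notMem_Anc _ _ k.1)
  have h'' : M.Trail (B ∪ {X})ᶜ (M.Anc {Y, Z}) Y v Z u := by
    rw [Set.pair_comm]
    exact h'.symm
  by_cases hv : v
  · exact force hYZ.symm hXY h'' hv
  · exact absurd (hM.eq_of_mem_Anc (anc hXY h'' hv) hZY) hYZ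

/-- Let `b` be a child of `X`, and let a walk of colliders to `z` continue in `r` a walk of
colliders from `X` to an ancestor `r` of `b`. Then the former walk can be replaced by one that
starts in `b`. -/
theorem exists_shortcut (hM : M.IsMAG) (hXB : X ∉ B)
    (hB : ∀ u s t, M.Trail ∅ Set.univ X s u t → u ≠ X → u ∈ B)
    (hT : ∀ Y, M.skeleton.Adj X Y → ∀ Z ∈ B, Z ≠ Y → M.Inducing B Y Z → M.Inducing (B ∪ {X}) Y Z)
    {b z r : α} {C : Set α} {s t : Prop} (hXb : M.Dir X b) (hz : z ≠ X)
    (h : M.Trail ∅ C r s z t) (hs : s) (hrb : r ∈ M.Anc {b})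
    (hr : r = X ∨ ∃ n m, m ∧ M.Trail ∅ (M.Anc {b}) X n r m) :
    ∃ u v, u ∧ M.Trail ∅ C b u z v := by
  have step : ∀ {r y : α}, M.skeleton.Adj r y → M.head y r → r ∈ M.Anc {b} →
      (r = X ∨ ∃ n m, m ∧ M.Trail ∅ (M.Anc {b}) X n r m) → y ≠ X →
      (∃ n, M.Trail ∅ (M.Anc {b}) X n y (M.head r y)) ∧ M.skeleton.Adj b y ∧ M.head y b := by
    intro r y h hs hrb hr hyX
    have hreach : ∃ n, M.Trail ∅ (M.Anc {b}) X n y (M.head r y) := by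
      obtain rfl | ⟨n, m, hm, hr⟩ := hr
      · exact ⟨_, .edge h⟩
      · exact ⟨n, hr.trans ⟨fun k => absurd ⟨hm, hs⟩ k, fun _ => hrb⟩ (.edge h)⟩
    have hyb : y ≠ b := by
      rintro rfl
      exact hM.notMem_Anc _ _ hs hrb
    obtain ⟨n, hn⟩ := hreach
    have hadj := adj_of_criterion hM hXB hB hT hXb (hn.mono subset_rfl (Anc_mono (by simp))) hyb hyX
    refine ⟨⟨n, hn⟩, hadj.symm, ?_⟩
    by_contra k
    have k' := hM.head_of_not_head hXb.1 hadj.symm k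
    exact hM.notMem_Anc _ _ hs (mem_Anc_trans hrb (mem_Anc_of_Dir ⟨k', k⟩ (subset_Anc _ rfl)))
  induction h with
  | @edge r z h =>
    obtain ⟨-, hadj, hhead⟩ := step h hs hrb hr hz
    exact ⟨_, _, hhead, .edge hadj⟩
  | @cons r y z s' t h p T ih =>
    have k := p.collider
    by_cases hyX : y = X
    · exact ih hz k.2 (hyX ▸ mem_Anc_of_Dir hXb (subset_Anc _ rfl)) (.inl hyX)
    · obtain ⟨⟨n, hn⟩, hadj, hhead⟩ := step h hs hrb hr hyX
      by_cases hby : M.head b y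
      · exact ⟨_, _, hhead, .cons hadj ⟨fun e => absurd ⟨hby, k.2⟩ e, fun _ => p.2 k⟩ T⟩
      · exact ih hz k.2 (mem_Anc_of_Dir ⟨hhead, hby⟩ (subset_Anc _ rfl)) (.inr ⟨n, _, k.1, hn⟩)

/-- The case of `adj_of_trails` in which one trail is an edge and the other one starts with a
directed edge to a collider. -/
theorem adj_of_edge_of_trail (hM : M.IsMAG) (hXB : X ∉ B)
    (hB : ∀ u s t, M.Trail ∅ Set.univ X s u t → u ≠ X → u ∈ B)
    (hT : ∀ Y, M.skeleton.Adj X Y → ∀ Z ∈ B, Z ≠ Y → M.Inducing B Y Z → M.Inducing (B ∪ {X}) Y Z)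
    {Y Z a : α} (hYZ : Y ≠ Z) (hZX : Z ≠ X) (hXY : M.skeleton.Adj X Y) (hXa : M.Dir X a)
    (ha : a ∈ M.Anc {Y, Z}) {s t : Prop} (hs : s) (h : M.Trail ∅ (M.Anc {Y, Z}) a s Z t) :
    M.skeleton.Adj Y Z := by
  by_cases hdir : M.Dir X Y
  · refine (adj_of_criterion hM hXB hB hT hdir (s := M.head a X) (t := t) ?_ hYZ.symm hZX).symm
    rw [Set.pair_comm]
    exact .cons (M.adj_of_head _ _ hXa.1) ⟨fun k => absurd ⟨hXa.1, hs⟩ k, fun _ => ha⟩ h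
  have haY : Y ≠ a := by
    rintro rfl
    exact hdir hXa
  have hadj := adj_of_criterion hM hXB hB hT hXa (.edge hXY) haY hXY.ne'
  have hYa : M.head Y a := by
    by_contra k
    have hdir' : M.Dir a Y := ⟨hM.head_of_not_head hXa.1 hadj.symm k, k⟩
    have hX : ¬ M.head Y X := fun k' => hM.notMem_Anc _ _ k'
      (mem_Anc_of_Dir hXa (mem_Anc_of_Dir hdir' (subset_Anc _ rfl)))
    exact hdir ⟨(hM.noUndirAtHead _ _ hdir'.1 _ hXY.symm).resolve_right hX, hX⟩
  exact hM.adj_of_trail hYZ (.cons hadj ⟨fun k => absurd ⟨hYa, hs⟩ k, fun _ => ha⟩ h)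

/-- Under the local criterion, two vertices are adjacent if they are joined by an inducing trail
through `X` that does not have other non-colliders and leaves `X` through a tail. -/
theorem adj_of_trails (hM : M.IsMAG) (hXB : X ∉ B)
    (hB : ∀ u s t, M.Trail ∅ Set.univ X s u t → u ≠ X → u ∈ B)
    (hT : ∀ Y, M.skeleton.Adj X Y → ∀ Z ∈ B, Z ≠ Y → M.Inducing B Y Z → M.Inducing (B ∪ {X}) Y Z)
    (hC : M.undirected.CliqueSeparators)
    {Y Z : α} (hYZ : Y ≠ Z) (hYX : Y ≠ X) (hZX : Z ≠ X) {s t m m' : Prop}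
    (h₁ : M.Trail ∅ (M.Anc {Y, Z}) X m Y s) (h₂ : M.Trail ∅ (M.Anc {Y, Z}) X m' Z t)
    (hm : ¬ m') : M.skeleton.Adj Y Z := by
  have hcomm := Set.pair_comm Y Z
  cases h₂ with
  | edge h₂ =>
    by_cases hXZ : M.head X Z
    · exact adj_of_criterion hM hXB hB hT ⟨hXZ, hm⟩ h₁ hYZ hYX
    -- `X` and `Z` are joined by an undirected edge
    have hX : ∀ w, ¬ M.head w X := fun w hw => (hM.noUndirAtHead _ _ hw _ h₂).elim hm hXZ
    have hZ : ∀ w, ¬ M.head w Z := fun w hw => (hM.noUndirAtHead _ _ hw _ h₂.symm).elim hXZ hm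
    cases h₁ with
    | edge h₁ =>
      by_cases hXY : M.head X Y
      · exact (adj_of_criterion hM hXB hB hT ⟨hXY, hX _⟩ (.edge h₂) hYZ.symm hZX).symm
      have hY : ∀ w, ¬ M.head w Y := fun w hw =>
        (hM.noUndirAtHead _ _ hw _ h₁.symm).elim hXY (hX _)
      have hYB := hB _ _ _ (.edge h₁) hYX
      have hZB := hB _ _ _ (.edge h₂) hZX
      obtain ⟨u, v, h⟩ := hT Y h₁ Z hZB hYZ.symm ⟨_, _, .cons h₁.symm
        ⟨fun _ => hXB, fun k => absurd k.1 (hX _)⟩ (.edge h₂)⟩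
      obtain ⟨p, hp⟩ := h.exists_undirected_walk hM.noUndirAtHead hY hZ
      refine (hC {X} (B ∪ {X})ᶜ Y Z ?_ ?_ ?_ ?_ hYZ ?_ ⟨p, hp⟩).1
      · exact disjoint_compl_right.mono_left Set.subset_union_right
      · rintro _ rfl j hj hadj
        exact hj (.inl (hB _ _ _ (.edge hadj.1) hadj.1.ne'))
      · rintro (k | k)
        exacts [hYX k, k (.inl hYB)]
      · rintro (k | k)
        exacts [hZX k, k (.inl hZB)]
      · have e₁ : M.undirected.Adj Y X := ⟨h₁.symm, hX _, hXY⟩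
        have e₂ : M.undirected.Adj X Z := ⟨h₂, hXZ, hX _⟩
        exact ⟨.cons e₁ (.cons e₂ .nil), by simp⟩
    | cons h₁ p T =>
      have k := p.collider
      rw [hcomm] at T p
      exact (adj_of_edge_of_trail hM hXB hB hT hYZ.symm hYX h₂ ⟨k.1, hX _⟩ (p.2 k) k.2 T).symm
  | @cons _ a _ s' _ h₂ p T =>
    have k := p.collider
    have hXa : M.Dir X a := ⟨k.1, hm⟩
    cases h₁ with
    | edge h₁ => exact adj_of_edge_of_trail hM hXB hB hT hYZ hZX h₁ hXa (p.2 k) k.2 T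
    | @cons _ b _ s'' _ h₁ p' T' =>
      have k' := p'.collider
      by_cases hab : a = b
      · subst hab
        exact hM.adj_of_trail hYZ (T'.symm.trans ⟨fun e => absurd ⟨k'.2, k.2⟩ e, fun _ => p.2 k⟩ T)
      have hadj := adj_of_criterion hM hXB hB hT hXa (.edge h₁) (Ne.symm hab) h₁.ne'
      by_cases hba : M.head b a
      · by_cases hab' : M.head a b
        · exact hM.adj_of_trail hYZ (T'.symm.trans
            ⟨fun e => absurd ⟨k'.2, hab'⟩ e, fun _ => p'.2 k'⟩
            (.cons hadj ⟨fun e => absurd ⟨hba, k.2⟩ e, fun _ => p.2 k⟩ T))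
        · obtain ⟨u, v, hu, hT'⟩ := exists_shortcut hM hXB hB hT hXa hYX T' k'.2
            (mem_Anc_of_Dir ⟨hba, hab'⟩ (subset_Anc _ rfl)) (.inr ⟨_, _, k'.1, .edge h₁⟩)
          exact hM.adj_of_trail hYZ (hT'.symm.trans ⟨fun e => absurd ⟨hu, k.2⟩ e, fun _ => p.2 k⟩ T)
      · have hdir : M.Dir a b := ⟨hM.head_of_not_head hXa.1 hadj.symm hba, hba⟩
        have hab' := mem_Anc_of_Dir hdir (subset_Anc {b} rfl)
        obtain ⟨u, v, hu, hT'⟩ := exists_shortcut hM hXB hB hT (b := b)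
          ⟨k'.1, fun e => hM.notMem_Anc _ _ e (mem_Anc_of_Dir hXa hab')⟩ hZX T k.2
          hab' (.inr ⟨_, _, k.1, .edge h₂⟩)
        exact hM.adj_of_trail hYZ (T'.symm.trans ⟨fun e => absurd ⟨k'.2, hu⟩ e, fun _ => p'.2 k'⟩
          hT')

/-- An inducing trail relative to the vertices other than `X` either has no non-collider or runs
through `X` as its only non-collider. -/
theorem Inducing.adj_or_exists_trails (hM : M.IsMAG) {Y Z : α} (hYZ : Y ≠ Z)
    (h : M.Inducing (M.verts \ {X}) Y Z) : M.skeleton.Adj Y Z ∨ ∃ s t m m', ¬(m ∧ m') ∧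
      M.Trail ∅ (M.Anc {Y, Z}) X m Y s ∧ M.Trail ∅ (M.Anc {Y, Z}) X m' Z t := by
  obtain ⟨s, t, h⟩ := h
  have h := h.refine_sets.mono (C' := M.Anc {Y, Z}) subset_rfl (Set.sep_subset _ _)
  have hN : ((M.verts \ {X})ᶜ ∩ M.verts) \ {X} ⊆ ∅ := fun v hv => hv.1.1 ⟨hv.1.2, hv.2⟩
  obtain h | ⟨m, m', hm, h₁, h₂⟩ := h.split_both hM.noUndirAtHead (ancClosed_Anc _)
    (subset_Anc _ (by simp)) X
  · exact .inl (hM.adj_of_trail hYZ (h.mono hN subset_rfl))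
  · exact .inr ⟨s, t, m, m', hm, h₁.symm.mono hN subset_rfl, h₂.mono hN subset_rfl⟩

/-- Under the local criterion, the marginalization of `X` creates no new adjacencies. -/
theorem adj_of_inducing_of_criterion (hM : M.IsMAG) (hXB : X ∉ B)
    (hB : ∀ u s t, M.Trail ∅ Set.univ X s u t → u ≠ X → u ∈ B)
    (hT : ∀ Y, M.skeleton.Adj X Y → ∀ Z ∈ B, Z ≠ Y → M.Inducing B Y Z → M.Inducing (B ∪ {X}) Y Z)
    (hC : M.undirected.CliqueSeparators)
    {Y Z : α} (hYZ : Y ≠ Z) (hYX : Y ≠ X) (hZX : Z ≠ X) (h : M.Inducing (M.verts \ {X}) Y Z) :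
    M.skeleton.Adj Y Z := by
  obtain h | ⟨s, t, m, m', hm, h₁, h₂⟩ := h.adj_or_exists_trails hM hYZ
  · exact h
  by_cases hm' : m'
  · rw [Set.pair_comm] at h₁ h₂
    exact (adj_of_trails hM hXB hB hT hC hYZ.symm hZX hYX h₂ h₁ fun k => hm ⟨k, hm'⟩).symm
  · exact adj_of_trails hM hXB hB hT hC hYZ hYX hZX h₁ h₂ hm'

/-! ### Existence of removable vertices -/

/-- A vertex all of whose edges have an arrowhead at it is never an inner non-collider. -/
theorem adj_of_inducing_of_sink (hM : M.IsMAG) (hX : ∀ w, M.skeleton.Adj X w → M.head w X)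
    {Y Z : α} (hYZ : Y ≠ Z) (h : M.Inducing (M.verts \ {X}) Y Z) : M.skeleton.Adj Y Z := by
  obtain h | ⟨s, t, m, m', hm, h₁, h₂⟩ := h.adj_or_exists_trails hM hYZ
  · exact h
  · obtain ⟨w, hw, hw'⟩ := h₁.exists_adj_left
    obtain ⟨v, hv, hv'⟩ := h₂.exists_adj_left
    exact absurd ⟨hw'.2 (hX w hw), hv'.2 (hX v hv)⟩ hm

/-- In a graph with undirected edges only, a simplicial vertex is removable. -/
theorem adj_of_inducing_of_simplicial (hM : M.IsMAG) (hU : ∀ a b, ¬ M.head a b)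
    (hX : ∀ a b, M.skeleton.Adj X a → M.skeleton.Adj X b → a ≠ b → M.skeleton.Adj a b)
    {Y Z : α} (hYZ : Y ≠ Z) (h : M.Inducing (M.verts \ {X}) Y Z) : M.skeleton.Adj Y Z := by
  obtain h | ⟨s, t, m, m', hm, h₁, h₂⟩ := h.adj_or_exists_trails hM hYZ
  · exact h
  · have edge : ∀ {C : Set α} {w : α} {m s : Prop}, M.Trail ∅ C X m w s → M.skeleton.Adj X w := by
      intro C w m s h
      cases h with
      | edge h => exact h
      | cons h p T => exact absurd (p.1 fun k => hU _ _ k.1) (Set.notMem_empty _)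
    exact hX _ _ (edge h₁) (edge h₂) hYZ

end Criterion
end MixedGraph

namespace SimpleGraph

/-! ### Chordal graphs -/

section Chordal

variable {α : Type*} {H : SimpleGraph α}

theorem Walk.mk_getVert_mem_edges {y z : α} (p : H.Walk y z) {i : ℕ} (hi : i < p.length) :
    s(p.getVert i, p.getVert (i + 1)) ∈ p.edges := by
  induction p generalizing i with
  | nil => simp at hi
  | cons h p ih =>
    obtain _ | i := i
    · simp
    · simp only [Walk.length_cons, Nat.add_lt_add_iff_right] at hi
      simp only [Walk.getVert_cons_succ, Walk.edges_cons, List.mem_cons]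
      exact .inr (ih hi)

/-- If there is a walk from `y` to `z` within a set of vertices, then there is an induced path. -/
theorem exists_induced_path {y z : α} {D : Set α} (h : ∃ p : H.Walk y z, ∀ v ∈ p.support, v ∈ D) :
    ∃ p : H.Walk y z, (∀ v ∈ p.support, v ∈ D) ∧ p.IsPath ∧
      ∀ a ∈ p.support, ∀ b ∈ p.support, H.Adj a b → s(a, b) ∈ p.edges := by
  classical
  have hn : ∃ n, ∃ p : H.Walk y z, (∀ v ∈ p.support, v ∈ D) ∧ p.length = n := by
    obtain ⟨p, hp⟩ := h
    exact ⟨_, p, hp, rfl⟩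
  obtain ⟨p, hp, hlen⟩ := Nat.find_spec hn
  have hmin : ∀ q : H.Walk y z, (∀ v ∈ q.support, v ∈ D) → p.length ≤ q.length := fun q hq => by
    rw [hlen]
    exact Nat.find_min' hn ⟨q, hq, rfl⟩
  have hpD : ∀ v ∈ p.bypass.support, v ∈ D := fun v hv => hp v (p.support_bypass_subset_support hv)
  have hmin' : ∀ q : H.Walk y z, (∀ v ∈ q.support, v ∈ D) → p.bypass.length ≤ q.length :=
    fun q hq => p.length_bypass_le_length.trans (hmin q hq)
  refine ⟨p.bypass, hpD, p.bypass_isPath, ?_⟩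
  generalize p.bypass = q at hpD hmin'
  have key : ∀ i j, i < j → j ≤ q.length → H.Adj (q.getVert i) (q.getVert j) →
      s(q.getVert i, q.getVert j) ∈ q.edges := by
    intro i j hij hj hadj
    by_cases hij' : j = i + 1
    · subst hij'
      exact q.mk_getVert_mem_edges hj
    · have := hmin' ((q.take i).append (.cons hadj (q.drop j))) (by
        intro v hv
        rw [Walk.mem_support_append_iff, Walk.support_cons, List.mem_cons] at hv
        refine hpD v ?_
        obtain hv | rfl | hv := hv
        · obtain ⟨n, rfl, -⟩ := Walk.mem_support_iff_exists_getVert.1 hv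
          rw [Walk.take_getVert]
          exact q.getVert_mem_support _
        · exact q.getVert_mem_support _
        · obtain ⟨n, rfl, -⟩ := Walk.mem_support_iff_exists_getVert.1 hv
          rw [Walk.drop_getVert]
          exact q.getVert_mem_support _)
      rw [Walk.length_append, Walk.length_cons, Walk.take_length, Walk.drop_length] at this
      omega
  intro a ha b hb hab
  obtain ⟨i, rfl, hi⟩ := Walk.mem_support_iff_exists_getVert.1 ha
  obtain ⟨j, rfl, hj⟩ := Walk.mem_support_iff_exists_getVert.1 hb
  obtain hij | rfl | hij := lt_trichotomy i j
  · exact key i j hij hj hab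
  · exact absurd hab (H.loopless.irrefl _)
  · rw [Sym2.eq_swap]
    exact key j i hij hi hab.symm

theorem IsChordal.cliqueSeparators (hH : H.IsChordal) : H.CliqueSeparators := by
  intro K J y z hKJ hadj hy hz hyz hK hJ
  by_contra hyz'
  obtain ⟨p, hpK, hp, hp'⟩ := exists_induced_path hK
  obtain ⟨q, hqJ, hq, hq'⟩ := exists_induced_path hJ
  have hlen : ∀ p : H.Walk y z, 2 ≤ p.length := by
    intro p
    by_contra! h
    obtain h | h : p.length = 0 ∨ p.length = 1 := by omega
    · exact hyz (Walk.eq_of_length_eq_zero h)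
    · exact hyz' (Walk.adj_of_length_eq_one h)
  have hpt : ∀ v ∈ p.support.tail, v ∈ K ∪ {z} := by
    intro v hv
    have hvy : v ≠ y := by
      rintro rfl
      have := hp.support_nodup
      rw [← Walk.cons_tail_support] at this
      exact (List.nodup_cons.1 this).1 hv
    obtain h | h | h := hpK v (List.mem_of_mem_tail hv)
    exacts [.inl h, absurd h hvy, .inr h]
  have hqt : ∀ v ∈ q.reverse.support.tail, v ∈ J ∪ {y} := by
    intro v hv
    have hvz : v ≠ z := by
      rintro rfl
      have := hq.reverse.support_nodup
      rw [← Walk.cons_tail_support] at this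
      exact (List.nodup_cons.1 this).1 hv
    have := List.mem_of_mem_tail hv
    rw [Walk.support_reverse, List.mem_reverse] at this
    obtain h | h | h := hqJ v this
    exacts [.inl h, .inr h, absurd h hvz]
  have hc : (p.append q.reverse).IsCycle := by
    refine hp.isCycle_append hq.reverse (fun v hv hv' => ?_) (.inl (hlen p))
    obtain h | rfl := hpt v hv
    · obtain h' | rfl := hqt v hv'
      exacts [Set.disjoint_left.1 hKJ h h', hy (.inl h)]
    · obtain h' | h' := hqt v hv'
      exacts [hz (.inr h'), hyz h'.symm]
  obtain ⟨a, ha, b, hb, hab, hne⟩ := hH _ _ hc (by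
    have := hlen p
    have := hlen q
    rw [Walk.length_append, Walk.length_reverse]
    omega)
  simp only [Walk.mem_support_append_iff, Walk.support_reverse, List.mem_reverse,
    Walk.edges_append, Walk.edges_reverse, List.mem_append, not_or] at ha hb hne
  have hcases : ∀ v, v ∈ p.support ∨ v ∈ q.support →
      (v ∉ p.support → v ∈ J ∧ v ∈ q.support) ∧ (v ∉ q.support → v ∈ K) := by
    refine fun v h => ⟨fun hv => ⟨?_, h.resolve_left hv⟩, fun hv => ?_⟩
    · obtain h | rfl | rfl := hqJ v (h.resolve_left hv)
      exacts [h, absurd p.start_mem_support hv, absurd p.end_mem_support hv]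
    · obtain h | rfl | rfl := hpK v (h.resolve_right hv)
      exacts [h, absurd q.start_mem_support hv, absurd q.end_mem_support hv]
  by_cases hap : a ∈ p.support
  · by_cases hbp : b ∈ p.support
    · exact hne.1 (hp' a hap b hbp hab)
    obtain ⟨hbJ, hbq⟩ := (hcases b hb).1 hbp
    by_cases haq : a ∈ q.support
    · exact hne.2 (hq' a haq b hbq hab)
    · exact hadj a ((hcases a ha).2 haq) b hbJ hab
  · obtain ⟨haJ, haq⟩ := (hcases a ha).1 hap
    by_cases hbq : b ∈ q.support
    · exact hne.2 (hq' a haq b hbq hab)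
    · exact hadj b ((hcases b hb).2 hbq) a haJ hab.symm

/-- The neighbors of `s` in `A` form a clique. -/
def IsSimplicialIn (H : SimpleGraph α) (A : Finset α) (s : α) : Prop :=
  s ∈ A ∧ ∀ a ∈ A, ∀ b ∈ A, H.Adj s a → H.Adj s b → a ≠ b → H.Adj a b

/-- A strong form of Dirac's theorem on simplicial vertices of chordal graphs. -/
theorem CliqueSeparators.exists_isSimplicialIn_not_adj (hH : H.CliqueSeparators) (A : Finset α) :
    ∀ x ∈ A, (∃ y ∈ A, y ≠ x ∧ ¬ H.Adj x y) →
      ∃ s, H.IsSimplicialIn A s ∧ s ≠ x ∧ ¬ H.Adj x s := by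
  classical
  induction A using Finset.strongInduction with
  | H A ih =>
  rintro x hx ⟨j₀, hj₀, hne₀, hadj₀⟩
  -- the component `J` of `j₀` in the graph without `x` and its neighbors
  let J : Set α := {v | Relation.ReflTransGen
    (fun a b => H.Adj a b ∧ b ∈ A ∧ b ≠ x ∧ ¬ H.Adj x b) j₀ v}
  have hJ : ∀ v ∈ J, v ∈ A ∧ v ≠ x ∧ ¬ H.Adj x v := by
    intro v hv
    obtain rfl | ⟨c, -, hc⟩ := Relation.ReflTransGen.cases_tail hv
    exacts [⟨hj₀, hne₀, hadj₀⟩, hc.2]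
  have hwalk : ∀ v ∈ J, ∃ p : H.Walk j₀ v, ∀ w ∈ p.support, w ∈ J := by
    intro v hv
    induction hv with
    | refl => exact ⟨.nil, by simp [J, Relation.ReflTransGen.refl]⟩
    | @tail b c hb hc ih =>
      obtain ⟨p, hp⟩ := ih
      refine ⟨p.concat hc.1, fun w hw => ?_⟩
      rw [Walk.support_concat, List.mem_append, List.mem_singleton] at hw
      obtain hw | rfl := hw
      exacts [hp w hw, .tail hb hc]
  let T : Set α := {t | t ∈ A ∧ H.Adj x t ∧ ∃ j ∈ J, H.Adj j t}
  have hT : ∀ t ∈ T, ∀ t' ∈ T, t ≠ t' → H.Adj t t' := by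
    rintro t ⟨htA, hxt, j, hj, hjt⟩ t' ⟨htA', hxt', j', hj', hjt'⟩ hne
    refine hH {x} J t t' ?_ ?_ ?_ ?_ hne ⟨.cons hxt.symm (.cons hxt' .nil), by simp⟩ ?_
    · rw [Set.disjoint_singleton_left]
      exact fun h => (hJ x h).2.1 rfl
    · rintro _ rfl j hj
      exact (hJ j hj).2.2
    · rintro (h | h)
      exacts [hxt.ne' h, (hJ t h).2.2 hxt]
    · rintro (h | h)
      exacts [hxt'.ne' h, (hJ t' h).2.2 hxt']
    · obtain ⟨p, hp⟩ := hwalk j hj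
      obtain ⟨p', hp'⟩ := hwalk j' hj'
      refine ⟨.cons hjt.symm ((p.reverse.append p').concat hjt'), fun v hv => ?_⟩
      simp only [Walk.support_cons, Walk.support_concat, List.mem_cons, List.mem_append,
        Walk.mem_support_append_iff, Walk.support_reverse, List.mem_reverse,
        List.not_mem_nil, or_false] at hv
      obtain rfl | (h | h) | rfl := hv
      exacts [.inr (.inl rfl), .inl (hp v h), .inl (hp' v h), .inr (.inr rfl)]
  let A' : Finset α := {v ∈ A | v ∈ J ∪ T}
  have hA' : ∀ {v}, v ∈ A' ↔ v ∈ J ∨ v ∈ T := by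
    intro v
    simp only [A', Finset.mem_filter, Set.mem_union]
    exact ⟨fun h => h.2, fun h => ⟨h.elim (fun h => (hJ v h).1) fun h => h.1, h⟩⟩
  have hlt : A' ⊂ A := by
    refine Finset.filter_ssubset.2 ⟨x, hx, ?_⟩
    rintro (h | h)
    exacts [(hJ x h).2.1 rfl, H.loopless.irrefl _ h.2.1]
  -- all neighbors of a vertex in `J` are in `A'`
  have hnb : ∀ j ∈ J, ∀ a ∈ A, H.Adj j a → a ∈ A' := by
    intro j hj a ha hja
    rw [hA']
    by_cases hxa : H.Adj x a
    · exact .inr ⟨ha, hxa, j, hj, hja⟩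
    · exact .inl (.tail hj ⟨hja, ha, fun h => (hJ j hj).2.2 (h ▸ hja.symm), hxa⟩)
  suffices h : ∃ s ∈ J, H.IsSimplicialIn A' s by
    obtain ⟨s, hs, hs'⟩ := h
    refine ⟨s, ⟨(hJ s hs).1, fun a ha b hb hsa hsb => ?_⟩, (hJ s hs).2⟩
    exact hs'.2 a (hnb s hs a ha hsa) b (hnb s hs b hb hsb) hsa hsb
  by_cases h₁ : ∃ t ∈ T, ∃ y ∈ A', y ≠ t ∧ ¬ H.Adj t y
  · obtain ⟨t, ht, h⟩ := h₁
    obtain ⟨s, hs, hst, hts⟩ := ih A' hlt t (hA'.2 (.inr ht)) h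
    refine ⟨s, (hA'.1 hs.1).resolve_right fun h => hts (hT t ht s h hst.symm), hs⟩
  push Not at h₁
  by_cases h₂ : ∃ j ∈ J, ∃ y ∈ A', y ≠ j ∧ ¬ H.Adj j y
  · obtain ⟨j, hj, h⟩ := h₂
    obtain ⟨s, hs, hsj, hjs⟩ := ih A' hlt j (hA'.2 (.inl hj)) h
    exact ⟨s, (hA'.1 hs.1).resolve_right fun h =>
      hjs (h₁ s h j (hA'.2 (.inl hj)) hsj.symm).symm, hs⟩
  push Not at h₂
  refine ⟨j₀, .refl, hA'.2 (.inl .refl), fun a ha b hb _ _ hab => ?_⟩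
  exact (hA'.1 ha).elim (fun h => h₂ a h b hb hab.symm) fun h => h₁ a h b hb hab.symm

theorem CliqueSeparators.exists_isSimplicialIn (hH : H.CliqueSeparators) {A : Finset α}
    (hA : A.Nonempty) : ∃ s, H.IsSimplicialIn A s := by
  by_cases h : ∃ x ∈ A, ∃ y ∈ A, y ≠ x ∧ ¬ H.Adj x y
  · obtain ⟨x, hx, h⟩ := h
    obtain ⟨s, hs, -⟩ := hH.exists_isSimplicialIn_not_adj A x hx h
    exact ⟨s, hs⟩
  · push Not at h
    obtain ⟨x, hx⟩ := hA
    exact ⟨x, hx, fun a ha b hb _ _ hab => h a ha b hb hab.symm⟩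

/-- `CliqueSeparators` passes to marginalizations: graphs over a subset of the vertices in which two
vertices are adjacent if they are connected through vertices outside of `V`. -/
theorem CliqueSeparators.of_marginal {H' : SimpleGraph α} {V D : Set α} (hD : D ⊆ V)
    (hH : H.CliqueSeparators) (hadj : ∀ a b, H'.Adj a b ↔ a ∈ D ∧ b ∈ D ∧ a ≠ b ∧
      ∃ p : H.Walk a b, ∀ v ∈ p.support, v ∈ Vᶜ ∪ {a, b}) : H'.CliqueSeparators := by
  classical
  intro K J y z hKJ hKJadj hy hz hyz hK hJ
  by_contra hyz'
  -- `ext K` adds to `K` the eliminated vertices that are connected to it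
  let ext (K : Set α) : Set α := {u | ∃ k ∈ K ∩ D, (u = k ∨ u ∉ V) ∧
    ∃ p : H.Walk k u, ∀ v ∈ p.support, v ∈ Vᶜ ∪ {k}}
  have hend : y ∈ D ∧ z ∈ D := by
    obtain ⟨p, -⟩ := hK
    have h₁ := p.adj_snd (Walk.not_nil_of_ne hyz)
    have h₂ := p.adj_penultimate (Walk.not_nil_of_ne hyz)
    exact ⟨((hadj _ _).1 h₁).1, ((hadj _ _).1 h₂).2.1⟩
  have hout : ∀ K : Set α, ∀ v ∈ D, v ∉ K → v ∉ ext K := by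
    rintro K v hv hvK ⟨k, hk, rfl | h, -⟩
    exacts [hvK hk.1, h (hD hv)]
  have hwalk : ∀ K : Set α, (∃ p : H'.Walk y z, ∀ v ∈ p.support, v ∈ K ∪ {y, z}) →
      ∃ p : H.Walk y z, ∀ v ∈ p.support, v ∈ ext K ∪ {y, z} := by
    rintro K ⟨p, hp⟩
    have hstep : ∀ a ∈ K ∪ {y, z}, ∀ b ∈ K ∪ {y, z}, H'.Adj a b →
        ∃ p : H.Walk a b, ∀ v ∈ p.support, v ∈ ext K ∪ {y, z} := by
      intro a ha b hb hab
      obtain ⟨haD, hbD, hne, q, hq⟩ := (hadj a b).1 hab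
      replace hq : ∀ v ∈ q.bypass.support, v ∈ Vᶜ ∪ {a, b} :=
        fun v hv => hq v (q.support_bypass_subset_support hv)
      have hqp := q.bypass_isPath
      generalize q.bypass = q at hq hqp
      refine ⟨q, ?_⟩
      -- the part of the path before an inner vertex does not contain the end
      have half : ∀ {a b : α} (q : H.Walk a b), q.IsPath → (∀ v ∈ q.support, v ∈ Vᶜ ∪ {a, b}) →
          a ∈ K → a ∈ D → ∀ v ∈ q.support, v ≠ b → v ∈ ext K := by
        intro a b q hqp hq haK haD v hv hvb
        refine ⟨a, ⟨haK, haD⟩, ?_, q.takeUntil v hv, fun w hw => ?_⟩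
        · obtain h | h | h := hq v hv
          exacts [.inr h, .inl h, absurd h hvb]
        · have hwb : w ≠ b := by
            rintro rfl
            exact Walk.endpoint_notMem_support_takeUntil hqp hv (Ne.symm hvb) hw
          obtain h | h | h := hq w (q.support_takeUntil_subset_support hv hw)
          exacts [.inl h, .inr h, absurd h hwb]
      have self : ∀ a ∈ K ∪ {y, z}, a ∈ D → a ∈ ext K ∪ {y, z} := by
        rintro a (h | h) haD
        exacts [.inl ⟨a, ⟨h, haD⟩, .inl rfl, .nil, by simp⟩, .inr h]
      intro v hv
      by_cases hva : v = a
      · exact hva ▸ self a ha haD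
      by_cases hvb : v = b
      · exact hvb ▸ self b hb hbD
      by_cases haK : a ∈ K
      · exact .inl (half q hqp hq haK haD v hv hvb)
      by_cases hbK : b ∈ K
      · exact .inl (half q.reverse hqp.reverse (by simpa [Set.pair_comm] using hq) hbK hbD v
          (by simpa using hv) hva)
      -- otherwise the edge joins `y` and `z`
      obtain rfl | rfl := ha.resolve_left haK <;> obtain rfl | rfl := hb.resolve_left hbK
      exacts [absurd rfl hne, absurd hab hyz', absurd hab.symm hyz', absurd rfl hne]
    suffices hind : ∀ {a c : α} (p : H'.Walk a c), c ∈ ({y, z} : Set α) →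
        (∀ v ∈ p.support, v ∈ K ∪ {y, z}) →
        ∃ p : H.Walk a c, ∀ v ∈ p.support, v ∈ ext K ∪ {y, z} from hind p (by simp) hp
    intro a c p hc hp
    induction p with
    | nil => exact ⟨.nil, fun v hv => .inr ((List.mem_singleton.1 hv) ▸ hc)⟩
    | @cons a b c h p ih =>
      rw [Walk.support_cons] at hp
      obtain ⟨q, hq⟩ := ih hc fun v hv => hp v (List.mem_cons_of_mem _ hv)
      obtain ⟨r, hr⟩ := hstep a (hp a List.mem_cons_self) b
        (hp b (List.mem_cons_of_mem _ p.start_mem_support)) h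
      exact ⟨r.append q, fun v hv => ((Walk.mem_support_append_iff _ _).1 hv).elim (hr v) (hq v)⟩
  have hjoin : ∀ u ∈ ext K, ∀ v ∈ ext J, ∀ q : H.Walk u v, (∀ w ∈ q.support, w = u ∨ w = v) →
      False := by
    rintro u ⟨k, hk, hku, p, hp⟩ v ⟨j, hj, hjv, p', hp'⟩ q hq
    refine hKJadj k hk.1 j hj.1 ((hadj k j).2 ⟨hk.2, hj.2, ?_, (p.append q).append p'.reverse, ?_⟩)
    · rintro rfl
      exact Set.disjoint_left.1 hKJ hk.1 hj.1
    · have h₁ : ∀ w ∈ p.support, w ∈ Vᶜ ∪ {k, j} := fun w hw =>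
        (hp w hw).imp_right fun h => .inl h
      have h₂ : ∀ w ∈ p'.support, w ∈ Vᶜ ∪ {k, j} := fun w hw =>
        (hp' w hw).imp_right fun h => .inr h
      intro w hw
      simp only [Walk.mem_support_append_iff, Walk.support_reverse, List.mem_reverse] at hw
      obtain (hw | hw) | hw := hw
      · exact h₁ w hw
      · obtain rfl | rfl := hq w hw
        exacts [h₁ _ p.end_mem_support, h₂ _ p'.end_mem_support]
      · exact h₂ w hw
  have hyz'' : H.Adj y z := by
    refine hH (ext K) (ext J) y z ?_ ?_ ?_ ?_ hyz (hwalk K hK) (hwalk J hJ)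
    · rw [Set.disjoint_left]
      exact fun u hu hu' => hjoin u hu u hu' .nil (by simp)
    · exact fun u hu v hv huv => hjoin u hu v hv (.cons huv .nil) (by simp)
    · exact fun h => h.elim (hout K y hend.1 fun h => hy (.inl h))
        (hout J y hend.1 fun h => hy (.inr h))
    · exact fun h => h.elim (hout K z hend.2 fun h => hz (.inl h))
        (hout J z hend.2 fun h => hz (.inr h))
  exact hyz' ((hadj y z).2 ⟨hend.1, hend.2, hyz, .cons hyz'' .nil, by simp⟩)

end Chordal
end SimpleGraph

namespace MixedGraph

/-! ### The undirected edges of a latent projection -/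

section Undirected

variable {α : Type*} {G : MixedGraph α} {V O S : Set α}

/-- A path of undirected edges is an open trail if its inner vertices are outside of `V`. -/
theorem exists_trail_of_undirected_walk {M : MixedGraph α} {C : Set α} {a b : α} (hab : a ≠ b)
    (h : ∃ p : M.undirected.Walk a b, ∀ v ∈ p.support, v ∈ Vᶜ ∪ {a, b}) :
    ∃ s t, M.Trail Vᶜ C a s b t := by
  classical
  obtain ⟨p, hp⟩ := h
  have hpath := p.bypass_isPath
  replace hp : ∀ v ∈ p.bypass.support, v ∈ Vᶜ ∪ {a, b} :=
    fun v hv => hp v (p.support_bypass_subset_support hv)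
  generalize p.bypass = p at hpath hp
  have hle : M.undirected ≤ M.skeleton := fun a b h => h.1
  have hopen : M.IsOpen Vᶜ C (p.mapLe hle) := by
    intro i hi
    rw [SimpleGraph.Walk.mapLe, SimpleGraph.Walk.length_map] at hi
    simp only [IsColliderAt, SimpleGraph.Walk.mapLe, SimpleGraph.Walk.getVert_map,
      SimpleGraph.Hom.ofLE_apply]
    refine ⟨fun _ => ?_, fun h => absurd h.1 (p.adj_getVert_succ (by omega)).2.1⟩
    obtain h | h | h := hp _ (p.getVert_mem_support (i + 1))
    · exact h
    · have := (hpath.getVert_eq_start_iff (i := i + 1) (by omega)).1 h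
      omega
    · have := (hpath.getVert_eq_end_iff (i := i + 1) (by omega)).1 h
      omega
  obtain ⟨t, ht⟩ := hopen.trail (SimpleGraph.Walk.not_nil_of_ne hab)
  exact ⟨_, t, ht⟩

/-- The undirected edges of the projection over `V` are the marginalization of those of the
projection over a larger set `O`. -/
theorem proj_undirected_adj_iff (hv : G.verts = Set.univ) (hG : G.IsDAG) (hOS : Disjoint O S)
    (hVO : V ⊆ O) (a b : α) : (G.proj V S).undirected.Adj a b ↔
      a ∈ V ∩ G.Anc S ∧ b ∈ V ∩ G.Anc S ∧ a ≠ b ∧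
        ∃ p : (G.proj O S).undirected.Walk a b, ∀ v ∈ p.support, v ∈ Vᶜ ∪ {a, b} := by
  constructor
  · rintro ⟨hadj, hab, hba⟩
    obtain ⟨ha, hb, hne, -⟩ := (proj_adj_iff hv hG).1 hadj
    have haS := proj_Undir_mem_Anc hG hadj hab hba
    have hbS := proj_Undir_mem_Anc hG hadj.symm hba hab
    refine ⟨⟨ha, haS⟩, ⟨hb, hbS⟩, hne, ?_⟩
    rw [proj_adj_iff_forall_not_MSep hv hG ha hb hne,
      forall_not_MSep_iff_inducing hv hG hOS hVO (hVO ha) (hVO hb) hne] at hadj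
    obtain ⟨s, t, h⟩ := hadj
    exact h.exists_undirected_walk (proj_noUndirAtHead hG)
      (fun w hw => proj_notMem_Anc_of_head hw haS) fun w hw => proj_notMem_Anc_of_head hw hbS
  · rintro ⟨⟨ha, haS⟩, ⟨hb, hbS⟩, hne, h⟩
    refine ⟨?_, fun h => proj_notMem_Anc_of_head h hbS, fun h => proj_notMem_Anc_of_head h haS⟩
    rw [proj_adj_iff_forall_not_MSep hv hG ha hb hne,
      forall_not_MSep_iff_inducing hv hG hOS hVO (hVO ha) (hVO hb) hne]
    exact exists_trail_of_undirected_walk hne h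

theorem proj_undirected_cliqueSeparators (hv : G.verts = Set.univ) (hG : G.IsDAG)
    (hOS : Disjoint O S) (hVO : V ⊆ O) (hC : (G.proj O S).undirected.CliqueSeparators) :
    (G.proj V S).undirected.CliqueSeparators :=
  hC.of_marginal Set.inter_subset_left (proj_undirected_adj_iff hv hG hOS hVO)

/-- If some vertex is not an ancestor of `S`, then one of these vertices without proper descendants
is a sink of the projection, and it can be removed. Otherwise all edges of the projection are
undirected, and a simplicial vertex can be removed. -/
theorem exists_proj_removable [Finite α] (hv : G.verts = Set.univ) (hG : G.IsDAG)
    (hVS : Disjoint V S) (hC : (G.proj V S).undirected.CliqueSeparators) (hV : V.Nonempty) :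
    ∃ X ∈ V, (G.proj V S).Removable X := by
  have hM := proj_isMAG hv hG hVS
  suffices h : ∃ X ∈ V, ∀ Y Z, Y ≠ Z → (G.proj V S).Inducing (V \ {X}) Y Z →
      (G.proj V S).skeleton.Adj Y Z by
    obtain ⟨X, hX, h⟩ := h
    exact ⟨X, hX, (proj_removable_iff hv hG hVS hX).2 fun Y _ Z _ hYZ => h Y Z hYZ⟩
  by_cases hVS' : V ⊆ G.Anc S
  · have hU : ∀ a b, ¬ (G.proj V S).head a b := fun a b h =>
      proj_notMem_Anc_of_head h (hVS' (((G.proj V S).mem_of_adj _ _ ((G.proj V S).adj_of_head _ _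
        h).symm)))
    obtain ⟨X, hX, hX'⟩ := hC.exists_isSimplicialIn (A := V.toFinite.toFinset) (by simpa using hV)
    rw [Set.Finite.mem_toFinset] at hX
    have hadj : ∀ {a b}, (G.proj V S).undirected.Adj a b ↔ (G.proj V S).skeleton.Adj a b :=
      ⟨fun h => h.1, fun h => ⟨h, hU _ _, hU _ _⟩⟩
    have hmem : ∀ {a b}, (G.proj V S).skeleton.Adj a b → b ∈ V :=
      fun h => (G.proj V S).mem_of_adj _ _ h.symm
    refine ⟨X, hX, fun Y Z hYZ h => adj_of_inducing_of_simplicial hM hU ?_ hYZ h⟩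
    intro a b ha hb hab
    exact (hX' a (by simpa using hmem ha) b (by simpa using hmem hb) (hadj.2 ha) (hadj.2 hb) hab).1
  · -- among the vertices that are not ancestors of `S`, choose one without proper descendants
    obtain ⟨X, ⟨hX, hXS⟩, hmin⟩ : ∃ X, (X ∈ V ∧ X ∉ G.Anc S) ∧
        ∀ Y, (Y ∈ V ∧ Y ∉ G.Anc S) → X ∈ G.Anc {Y} → Y ∈ G.Anc {X} := by
      let r : α → α → Prop := fun Y X => X ∈ G.Anc {Y} ∧ Y ∉ G.Anc {X}
      have : IsTrans α r := ⟨fun a b c h₁ h₂ => ⟨mem_Anc_trans h₂.1 h₁.1,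
        fun h => h₁.2 (mem_Anc_trans h h₂.1)⟩⟩
      have : Std.Irrefl r := ⟨fun a h => h.2 h.1⟩
      have hwf : WellFounded r := Finite.wellFounded_of_trans_of_irrefl r
      obtain ⟨X₀, hX₀⟩ := Set.not_subset.1 hVS'
      obtain ⟨X, hX, hmin⟩ := hwf.has_min {X | X ∈ V ∧ X ∉ G.Anc S} ⟨X₀, hX₀⟩
      exact ⟨X, hX, fun Y hY hXY => by_contra fun h => hmin Y hY ⟨hXY, h⟩⟩
    refine ⟨X, hX, fun Y Z hYZ h => adj_of_inducing_of_sink hM (fun w hw => ?_) hYZ h⟩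
    rw [proj_head_iff]
    refine ⟨hw.symm, fun hXw => ?_⟩
    rw [Anc_union] at hXw
    have hXw := hXw.resolve_right hXS
    have hwV : w ∈ V := (G.proj V S).mem_of_adj _ _ hw.symm
    exact hw.ne (hG.eq_of_mem_Anc hXw (hmin w ⟨hwV, fun k => hXS (mem_Anc_trans hXw k)⟩ hXw))

end Undirected
end MixedGraph

/-! ### Weak union for conditional independence -/

section CondIndep

variable {Ω : Type*} {mΩ : MeasurableSpace Ω} {μ : Measure Ω} [IsFiniteMeasure μ]

theorem MeasurableSpace.sup_eq_generateFrom_inter (m₁ m₂ : MeasurableSpace Ω) :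
    m₁ ⊔ m₂ = MeasurableSpace.generateFrom
      {s | ∃ c d, MeasurableSet[m₁] c ∧ MeasurableSet[m₂] d ∧ c ∩ d = s} := by
  apply le_antisymm
  · refine sup_le (fun c hc => ?_) fun d hd => ?_
    · exact MeasurableSpace.measurableSet_generateFrom
        ⟨c, Set.univ, hc, MeasurableSet.univ, Set.inter_univ c⟩
    · exact MeasurableSpace.measurableSet_generateFrom
        ⟨Set.univ, d, MeasurableSet.univ, hd, Set.univ_inter d⟩
  · refine MeasurableSpace.generateFrom_le ?_
    rintro _ ⟨c, d, hc, hd, rfl⟩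
    exact (le_sup_left (b := m₂) c hc).inter (le_sup_right (a := m₁) d hd)

theorem MeasurableSpace.isPiSystem_inter (m₁ m₂ : MeasurableSpace Ω) :
    IsPiSystem {s | ∃ c d, MeasurableSet[m₁] c ∧ MeasurableSet[m₂] d ∧ c ∩ d = s} := by
  rintro _ ⟨c, d, hc, hd, rfl⟩ _ ⟨c', d', hc', hd', rfl⟩ -
  exact ⟨c ∩ c', d ∩ d', hc.inter hc', hd.inter hd', Set.inter_inter_inter_comm c c' d d'⟩

theorem integrable_indicator_one {t : Set Ω} (ht : MeasurableSet t) :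
    Integrable (t.indicator fun _ => (1 : ℝ)) μ :=
  (integrable_const 1).indicator ht

variable [StandardBorelSpace Ω] {mC mX mD : MeasurableSpace Ω}

/-- Further information that is conditionally independent of an event does not change the
conditional probability of the event. -/
theorem ProbabilityTheory.CondIndep.condExp_sup_eq (hC : mC ≤ mΩ) (hX : mX ≤ mΩ) (hD : mD ≤ mΩ)
    (h : CondIndep mC mX mD hC μ) {t : Set Ω} (ht : MeasurableSet[mX] t) :
    μ⟦t | mC ⊔ mD⟧ =ᵐ[μ] μ⟦t | mC⟧ := by
  have hCD : mC ⊔ mD ≤ mΩ := sup_le hC hD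
  have htint := integrable_indicator_one (μ := μ) (hX t ht)
  have hint : ∀ s, MeasurableSet[mC ⊔ mD] s →
      ∫ ω in s, (μ⟦t | mC⟧) ω ∂μ = ∫ ω in s, t.indicator (fun _ => (1 : ℝ)) ω ∂μ := by
    intro s hs
    induction s, hs using MeasurableSpace.induction_on_inter
      (MeasurableSpace.sup_eq_generateFrom_inter mC mD)
      (MeasurableSpace.isPiSystem_inter mC mD) with
    | empty => simp
    | basic s hs =>
      obtain ⟨c, d, hc, hd, rfl⟩ := hs
      have hdint := integrable_indicator_one (μ := μ) (hD d hd)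
      have h₁ : (fun ω => d.indicator (μ⟦t | mC⟧) ω) =
          μ⟦t | mC⟧ * d.indicator (fun _ => (1 : ℝ)) := by
        ext ω
        by_cases hω : ω ∈ d <;> simp [hω]
      have hmul : Integrable (μ⟦t | mC⟧ * d.indicator (fun _ => (1 : ℝ))) μ := by
        rw [← h₁]
        exact integrable_condExp.indicator (hD d hd)
      have h₂ : μ[μ⟦t | mC⟧ * d.indicator (fun _ => (1 : ℝ)) | mC] =ᵐ[μ]
          μ⟦t ∩ d | mC⟧ := by
        refine (condExp_mul_of_stronglyMeasurable_left stronglyMeasurable_condExp hmul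
          hdint).trans ?_
        exact ((condIndep_iff mC mX mD hC hX hD μ).1 h t d ht hd).symm
      rw [← setIntegral_indicator (hD d hd), h₁, ← setIntegral_condExp hC hmul hc,
        setIntegral_congr_ae (hC c hc) (h₂.mono fun ω hω _ => hω),
        setIntegral_condExp hC (integrable_indicator_one ((hX t ht).inter (hD d hd))) hc,
        ← setIntegral_indicator (hD d hd)]
      congr 1 with ω
      simp [Set.indicator_indicator, Set.inter_comm]
    | compl s hs ih =>
      rw [setIntegral_compl (hCD s hs) integrable_condExp, setIntegral_compl (hCD s hs) htint, ih,
        integral_condExp hC]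
    | iUnion f hd hf ih =>
      rw [integral_iUnion (fun i => hCD _ (hf i)) hd integrable_condExp.integrableOn,
        integral_iUnion (fun i => hCD _ (hf i)) hd htint.integrableOn]
      simp only [ih]
  exact (ae_eq_condExp_of_forall_setIntegral_eq hCD htint
    (fun _ _ _ => integrable_condExp.integrableOn) (fun s hs _ => hint s hs)
    (stronglyMeasurable_condExp.mono le_sup_left).aestronglyMeasurable).symm

/-- Weak union: part of the information that is conditionally independent of `mX` may be moved into
the condition. -/
theorem ProbabilityTheory.CondIndep.weak_union {m mB : MeasurableSpace Ω} (hC : mC ≤ mΩ)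
    (hX : mX ≤ mΩ) (hD : mD ≤ mΩ) (h : CondIndep mC mX mD hC μ) (hm : mC ≤ m) (hm' : m ≤ mC ⊔ mD)
    (hB : mB ≤ mC ⊔ mD) : CondIndep m mX mB (hm'.trans (sup_le hC hD)) μ := by
  have hCD : mC ⊔ mD ≤ mΩ := sup_le hC hD
  have hmΩ := hm'.trans hCD
  have hBΩ := hB.trans hCD
  rw [condIndep_iff m mX mB hmΩ hX hBΩ]
  intro t d ht hd
  have hcond := h.condExp_sup_eq hC hX hD ht
  have htint := integrable_indicator_one (μ := μ) (hX t ht)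
  have hdint := integrable_indicator_one (μ := μ) (hBΩ d hd)
  have hmeas : StronglyMeasurable[m] (μ⟦t | mC⟧) := stronglyMeasurable_condExp.mono hm
  have h₀ : μ⟦t | m⟧ =ᵐ[μ] μ⟦t | mC⟧ := by
    refine (condExp_condExp_of_le hm' hCD).symm.trans ((condExp_congr_ae hcond).trans ?_)
    rw [condExp_of_stronglyMeasurable hmΩ hmeas integrable_condExp]
  have h₁ : d.indicator (μ⟦t | mC⟧) = μ⟦t | mC⟧ * d.indicator (fun _ => (1 : ℝ)) := by
    ext ω
    by_cases hω : ω ∈ d <;> simp [hω]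
  have hmul : Integrable (μ⟦t | mC⟧ * d.indicator (fun _ => (1 : ℝ))) μ := by
    rw [← h₁]
    exact integrable_condExp.indicator (hBΩ d hd)
  have h₂ : μ⟦t ∩ d | mC ⊔ mD⟧ =ᵐ[μ] μ⟦t | mC⟧ * d.indicator (fun _ => (1 : ℝ)) := by
    rw [← h₁, Set.inter_comm, ← Set.indicator_indicator]
    exact (condExp_indicator htint (hB d hd)).trans (hcond.indicator)
  refine (condExp_condExp_of_le hm' hCD).symm.trans ((condExp_congr_ae h₂).trans ?_)
  refine (condExp_mul_of_stronglyMeasurable_left hmeas hmul hdint).trans ?_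
  exact h₀.symm.mul .rfl

end CondIndep

section CI

variable {ι : Type*} [Finite ι] {E : ι → Type*} [∀ i, MeasurableSpace (E i)]
  [∀ i, StandardBorelSpace (E i)]

theorem comap_domRestrict_eq_iSup {ι : Type*} {E : ι → Type*} [∀ i, MeasurableSpace (E i)]
    (A : Set ι) : MeasurableSpace.comap (A.domRestrict (π := E)) inferInstance =
      ⨆ i ∈ A, MeasurableSpace.comap (fun ω : ∀ i, E i => ω i) inferInstance := by
  simp only [MeasurableSpace.pi, MeasurableSpace.comap_iSup, MeasurableSpace.comap_comp]
  rw [iSup_subtype]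
  rfl

/-- A variable outside of a set that renders `X` independent of the remaining variables is
independent of `X` given all other variables. -/
theorem CI.of_markov_blanket {P : Measure (∀ i, E i)} [IsFiniteMeasure P] {S V B : Set ι} {X z : ι}
    (hB : B ⊆ V \ {X}) (h : CI P {X} (V \ ({X} ∪ B)) (B ∪ S)) (hz : z ∈ V \ ({X} ∪ B)) :
    CI P {X} {z} (V \ {X, z} ∪ S) := by
  rw [CI, condIndepFun_iff_condIndep] at h ⊢
  have hle : ∀ A : Set ι, MeasurableSpace.comap (A.domRestrict (π := E)) inferInstance ≤
      MeasurableSpace.pi := fun A => (Set.measurable_restrict A).comap_le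
  refine h.weak_union (hle _) (hle _) (hle _) ?_ ?_ ?_
  all_goals simp only [comap_domRestrict_eq_iSup, ← iSup_union]
  all_goals refine biSup_mono fun i hi => ?_
  · obtain hi | hi := hi
    · refine .inl ⟨(hB hi).1, ?_⟩
      rintro (rfl | rfl)
      exacts [(hB hi).2 rfl, hz.2 (.inr hi)]
    · exact .inr hi
  · obtain hi | hi := hi
    · by_cases hiB : i ∈ B
      · exact .inl (.inl hiB)
      · exact .inr ⟨hi.1, fun h => h.elim (fun h => hi.2 (.inl h)) hiB⟩
    · exact .inl (.inr hi)
  · rw [Set.mem_singleton_iff.1 hi]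
    exact .inr hz

end CI

/-! ### Removability from conditional independences -/

namespace MixedGraph

/-- Under faithfulness, conditional independence of observed variables given further observed
variables and the selection variables is m-separation in the causal graph. -/
theorem _root_.Faithful.CI_iff_MSep {ι : Type*} [Finite ι] {E : ι → Type*}
    [∀ i, MeasurableSpace (E i)] [∀ i, StandardBorelSpace (E i)] {G : MixedGraph ι}
    (hG : G.verts = Set.univ) {P : Measure (∀ i, E i)} [IsFiniteMeasure P] (hP : Faithful P G)
    {V S : Set ι} (hVS : Disjoint V S) {Y Z : ι} (hY : Y ∈ V) (hZ : Z ∈ V) (hYZ : Y ≠ Z)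
    {W : Set ι} (hW : W ⊆ V \ {Y, Z}) : CI P {Y} {Z} (W ∪ S) ↔ G.MSep Y Z (W ∪ S) := by
  refine hP Y (by simp [hG]) Z (by simp [hG]) hYZ _ fun v hv => ⟨by simp [hG], ?_⟩
  obtain hv | hv := hv
  · exact (hW hv).2
  · rintro (rfl | rfl)
    exacts [Set.disjoint_left.1 hVS hY hv, Set.disjoint_left.1 hVS hZ hv]

/-- A Markov boundary of `X` contains all vertices that are reached from `X` by a walk whose inner
vertices are colliders, as these depend on `X` given all other variables. -/
theorem _root_.IsMarkovBoundary.mem_of_trail {ι : Type*} [Finite ι] {E : ι → Type*}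
    [∀ i, MeasurableSpace (E i)] [∀ i, StandardBorelSpace (E i)] {G : MixedGraph ι}
    (hG : G.verts = Set.univ) (hDAG : G.IsDAG) {P : Measure (∀ i, E i)} [IsFiniteMeasure P]
    (hP : Faithful P G) {V S : Set ι} (hVS : Disjoint V S) {X : ι} {Mb : Set ι}
    (hMb : IsMarkovBoundary P S V X Mb) {u : ι} {s t : Prop}
    (h : (G.proj V S).Trail ∅ Set.univ X s u t) (hu : u ≠ X) : u ∈ Mb := by
  by_contra huMb
  have hXV : X ∈ V := h.mem_left
  have huV : u ∈ V := h.symm.mem_left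
  have hCI := CI.of_markov_blanket hMb.1.1 hMb.1.2 (z := u)
    ⟨huV, fun k => k.elim (fun k => hu k) huMb⟩
  rw [hP.CI_iff_MSep hG hVS hXV huV hu.symm subset_rfl,
    ← proj_MSep_iff hG hDAG hVS hXV huV Set.sdiff_subset] at hCI
  refine (not_MSep_iff (proj_noUndirAtHead hDAG) hu.symm).2 ⟨s, t, h.refine_sets.mono (by simp) ?_⟩
    hCI
  rintro c ⟨-, w, hw⟩
  refine subset_Anc _ ?_
  rw [Set.union_sdiff_self]
  exact .inr ((G.proj V S).mem_of_adj _ _ ((G.proj V S).adj_of_head _ _ hw).symm)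

end MixedGraph

theorem mainTheorem3 {ι : Type*} [Finite ι] {E : ι → Type*} [∀ i, MeasurableSpace (E i)]
    [∀ i, StandardBorelSpace (E i)]
    -- the causal graph is a directed acyclic graph over the variables
    (G : MixedGraph ι) (hG : G.verts = Set.univ) (hDAG : G.IsDAG)
    -- observed, latent and selection variables
    (O L S : Set ι) (hOL : Disjoint O L) (hOS : Disjoint O S) (hLS : Disjoint L S)
    (hOLS : O ∪ L ∪ S = Set.univ)
    -- the joint distribution is faithful to the causal graph
    (P : MeasureTheory.Measure (∀ i, E i)) [MeasureTheory.IsProbabilityMeasure P]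
    (hP : Faithful P G)
    -- the undirected edges of the ground truth MAG form a chordal graph
    (hchordal : (G.proj O S).undirected.IsChordal)
    (V : Set ι) (hVO : V ⊆ O) (hV : V.Nonempty) :
    (∀ X ∈ V, ∀ Mb : Set ι, IsMarkovBoundary P S V X Mb →
      ((G.proj V S).Removable X ↔
        ∀ Y, (G.proj V S).skeleton.Adj X Y → ∀ Z ∈ Mb, Z ≠ Y →
          (∃ W ⊆ Mb \ {Y, Z}, CI P {Y} {Z} (W ∪ S)) ∨
          (∀ W ⊆ Mb \ {Y, Z}, ¬ CI P {Y} {Z} (W ∪ {X} ∪ S)))) ∧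
    ∃ X ∈ V, (G.proj V S).Removable X := by
  have hVS : Disjoint V S := hOS.mono_left hVO
  have hM := MixedGraph.proj_isMAG hG hDAG hVS
  have hC := MixedGraph.proj_undirected_cliqueSeparators hG hDAG hOS hVO hchordal.cliqueSeparators
  refine ⟨fun X hX Mb hMb => ?_, MixedGraph.exists_proj_removable hG hDAG hVS hC hV⟩
  have hB : ∀ u s t, (G.proj V S).Trail ∅ Set.univ X s u t → u ≠ X → u ∈ Mb :=
    fun u s t h hu => hMb.mem_of_trail hG hDAG hP hVS h hu
  have hMbV : Mb ⊆ V := hMb.1.1.trans Set.sdiff_subset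
  have hXMb : X ∉ Mb := fun h => (hMb.1.1 h).2 rfl
  -- the condition on `Y` and `Z`, stated in terms of the projection
  have key : ∀ Y, (G.proj V S).skeleton.Adj X Y → ∀ Z ∈ Mb, Z ≠ Y →
      (((∃ W ⊆ Mb \ {Y, Z}, CI P {Y} {Z} (W ∪ S)) ∨
        (∀ W ⊆ Mb \ {Y, Z}, ¬ CI P {Y} {Z} (W ∪ {X} ∪ S))) ↔
      ((G.proj V S).Inducing Mb Y Z → (G.proj V S).Inducing (Mb ∪ {X}) Y Z)) := by
    intro Y hXY Z hZ hZY
    have hY : Y ∈ V := (G.proj V S).mem_of_adj _ _ hXY.symm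
    have hXZ : X ≠ Z := fun h => hXMb (h ▸ hZ)
    have hMbX : Mb ∪ {X} ⊆ V := Set.union_subset hMbV (by simpa using hX)
    rw [← MixedGraph.forall_not_MSep_iff_inducing hG hDAG hVS hMbV hY (hMbV hZ) hZY.symm,
      ← MixedGraph.forall_not_MSep_iff_inducing hG hDAG hVS hMbX hY (hMbV hZ) hZY.symm]
    have hCI : ∀ W ⊆ V \ {Y, Z}, (CI P {Y} {Z} (W ∪ S) ↔ G.MSep Y Z (W ∪ S)) :=
      fun W hW => hP.CI_iff_MSep hG hVS hY (hMbV hZ) hZY.symm hW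
    have hsub : ∀ {W}, W ⊆ Mb \ {Y, Z} → W ⊆ V \ {Y, Z} :=
      fun h => h.trans (Set.sdiff_subset_sdiff_left hMbV)
    have hsubX : ∀ {W}, W ⊆ Mb \ {Y, Z} → W ∪ {X} ⊆ (Mb ∪ {X}) \ {Y, Z} := by
      rintro W hW v (hv | rfl)
      · exact ⟨.inl (hW hv).1, (hW hv).2⟩
      · exact ⟨.inr rfl, fun k => k.elim hXY.ne hXZ⟩
    have hsubX' : ∀ {W}, W ⊆ Mb \ {Y, Z} → W ∪ {X} ⊆ V \ {Y, Z} :=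
      fun h => (hsubX h).trans (Set.sdiff_subset_sdiff_left hMbX)
    constructor
    · rintro (⟨W, hW, h⟩ | h) hind
      · exact absurd ((hCI W (hsub hW)).1 h) (hind W hW)
      · intro W hW
        have hW' : W \ {X} ⊆ Mb \ {Y, Z} := fun v hv =>
          ⟨(hW hv.1).1.resolve_right hv.2, (hW hv.1).2⟩
        by_cases hXW : X ∈ W
        · have := h _ hW'
          rwa [hCI _ (hsubX' hW'), Set.sdiff_union_of_subset (by simpa using hXW)] at this
        · have := hind _ hW'
          rwa [Set.sdiff_singleton_eq_self hXW] at this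
    · intro h
      by_contra! k
      obtain ⟨W, hW, hWCI⟩ := k.2
      rw [hCI _ (hsubX' hW)] at hWCI
      exact h (fun W hW e => k.1 W hW ((hCI W (hsub hW)).2 e)) _ (hsubX hW) hWCI
  rw [MixedGraph.proj_removable_iff hG hDAG hVS hX]
  constructor
  · intro h Y hXY Z hZ hZY
    have hY : Y ∈ V \ {X} := ⟨(G.proj V S).mem_of_adj _ _ hXY.symm, hXY.ne'⟩
    exact (key Y hXY Z hZ hZY).2
      (MixedGraph.Inducing.insert_of_removable hB (h Y hY Z (hMb.1.1 hZ) hZY.symm))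
  · intro h Y hY Z hZ hYZ
    exact MixedGraph.adj_of_inducing_of_criterion hM hXMb hB
      (fun Y hXY Z hZ hZY => (key Y hXY Z hZ hZY).1 (h Y hXY Z hZ hZY)) hC hYZ hY.2 hZ.2
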